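/- Let $m\ge 1$ and $\xi=\exp(2\pi i/m)$. For $n\ge 0$ let $G(m,1,n)$ be the group of $n\times n$ monomial matrices whose nonzero entries are $m$-th roots of unity. Write $[u;g]$, with $u\in S_n$ and $g\in(\mathbb Z/m)^n$, for the matrix whose nonzero entry in column $k$ is $\xi^{g_k}$ and stands in row $u(k)$. A colored partition is a family $\bar\lambda=\lambda_0|\dots|\lambda_{m-1}$ of partitions indexed by $\mathbb Z/m$. The colored partition of $[u;g]$ has in $\lambda_\alpha$ the lengths of those cycles $(i_1\dots i_r)$ of $u$ (fixed points included) with $g_{i_1}+\dots+g_{i_r}=\alpha$. Let $C_{\bar\lambda}$ be the set of elements of $G(m,1,n)$ with colored partition $\bar\lambda$; these sets are the conjugacy classes. Put $\mathcal C_{\bar\lambda}=\frac1{\#C_{\bar\lambda}}\sum_{x\in C_{\bar\lambda}}x$. Let $\mathbb C[\mathbf p]$ be the polynomial ring in the variables $p^{(\alpha)}_i$, $\alpha\in\mathbb Z/m$, $i\ge 1$, graded by $\deg p_i^{(\alpha)}=i$. Let $\Theta$ be the linear isomorphism from the center of $\mathbb C[G(m,1,n)]$ onto $\mathbb C[\mathbf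 p]_n$ given by $\Theta(\mathcal C_{\bar\lambda})=\prod_\alpha\prod_j p^{(\alpha)}_{\lambda_{\alpha,j}}$, where $j$ runs over the parts of $\lambda_\alpha$. Let $\mathcal T_0\in\mathbb C[G(m,1,n)]$ be the sum of all order-two reflections $r_{ij}^{(\alpha)}=[(i\,j);\dots,\alpha,\dots,-\alpha,\dots]$ with $1\le i<j\le n$, $\alpha\in\mathbb Z/m$ ($\alpha$ in position $i$, $-\alpha$ in position $j$, zeros elsewhere). For $1\le k\le m-1$ let $\mathcal T_k$ be the sum over $i=1,\dots,n$ of the diagonal reflections $[\mathrm{id};\dots,k,\dots]$ with $k$ in position $i$ and zeros elsewhere. The cut-and-join operator $\mathcal{CJ}_k$ ($0\le k\le m-1$) is the linear operator on $\mathbb C[\mathbf p]$ that preserves each $\mathbb C[\mathbf p]_n$ and is there the transport under $\Theta$ of multiplication by $\mathcal T_k$. For a sequence $x=(x_1,x_2,\dots)$ of elements of a commutative $\mathbb C$-algebra define $h_r(x)$ by $\sum_{r\ge0}h_r(x)t^r=\exp\bigl(\sum_{k\ge1}x_kt^k/k\bigr)$, put $h_r=0$ for $r<0$, and let $s_\lambda(x)=\det\bigl(h_{\lambda_i-i+j}(x)\bigr)_{1\le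 i,j\le\ell(\lambda)}$ be the Schur polynomial in terms of power sums. Put $$P^{(\alpha)}_i=\frac1m\sum_{\beta=0}^{m-1}\xi^{-\alpha\beta}p^{(\beta)}_i,\qquad \mathbf P^{(\alpha)}=(P^{(\alpha)}_1,P^{(\alpha)}_2,\dots),$$ so that $p^{(\alpha)}_i=\sum_\beta\xi^{\alpha\beta}P^{(\beta)}_i$. **Theorem.** For every colored partition $\bar\lambda=\lambda_0|\dots|\lambda_{m-1}$ the polynomial $$s_{\bar\lambda}=s_{\lambda_0}(\mathbf P^{(0)})\cdots s_{\lambda_{m-1}}(\mathbf P^{(m-1)})$$ is nonzero and is a common eigenvector of $\mathcal{CJ}_0,\mathcal{CJ}_1,\dots,\mathcal{CJ}_{m-1}$. Its eigenvalue for $\mathcal{CJ}_0$ is $$\frac m2\sum_{\alpha=0}^{m-1}\sum_{i\ge1}\lambda_{\alpha,i}(\lambda_{\alpha,i}-2i+1),$$ and its eigenvalue for $\mathcal{CJ}_k$, $1\le k\le m-1$, is $$\sum_{i\ge1}\sum_{\alpha=0}^{m-1}\xi^{k\alpha}\lambda_{\alpha,i}.$$ -/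

import Mathlib

open scoped BigOperators

/-!  The group `G(m,1,n)` -/

/-- An element of `G(m,1,n)`, encoded as a pair `[u; g]`: the monomial matrix whose only nonzero
entry in column `k` stands in row `u k` and equals `exp (2 π i g_k / m)`. -/
@[ext]
structure GMatrix (m n : ℕ) where
  perm : Equiv.Perm (Fin n)
  color : Fin n → ZMod m

namespace GMatrix

variable {m n : ℕ}

/-- The product rule `[u; g] [v; b] = [u v; v(g) + b]` with `v(g)_k = g_{v(k)}`. -/
instance : Mul (GMatrix m n) := ⟨fun w z => ⟨w.perm * z.perm, fun k => w.color (z.perm k) + z.color k⟩⟩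

instance : One (GMatrix m n) := ⟨⟨1, fun _ => 0⟩⟩

instance : Inv (GMatrix m n) := ⟨fun w => ⟨w.perm⁻¹, fun k => - w.color (w.perm⁻¹ k)⟩⟩

@[simp] theorem mul_perm (w z : GMatrix m n) : (w * z).perm = w.perm * z.perm := rfl
@[simp] theorem mul_color (w z : GMatrix m n) (k : Fin n) :
    (w * z).color k = w.color (z.perm k) + z.color k := rfl
@[simp] theorem one_perm : (1 : GMatrix m n).perm = 1 := rfl
@[simp] theorem one_color (k : Fin n) : (1 : GMatrix m n).color k = 0 := rfl
@[simp] theorem inv_perm (w : GMatrix m n) : (w⁻¹).perm = w.perm⁻¹ := rfl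
@[simp] theorem inv_color (w : GMatrix m n) (k : Fin n) :
    (w⁻¹).color k = - w.color (w.perm⁻¹ k) := rfl

instance : Group (GMatrix m n) :=
  Group.ofLeftAxioms
    (fun a b c => by
      ext k
      · simp [mul_assoc]
      · simp [add_assoc])
    (fun a => by
      ext k
      · simp
      · simp)
    (fun a => by
      ext k
      · simp
      · simp)

/-- The pairs `[u; g]` as a product type. -/
def equivProd (m n : ℕ) : GMatrix m n ≃ Equiv.Perm (Fin n) × (Fin n → ZMod m) where
  toFun w := (w.perm, w.color)
  invFun x := ⟨x.1, x.2⟩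

noncomputable instance [NeZero m] : Fintype (GMatrix m n) :=
  Fintype.ofEquiv _ (equivProd m n).symm

end GMatrix

/-- The primitive `m`-th root of unity `ξ = exp (2 π i / m)`. -/
noncomputable def xi (m : ℕ) : ℂ := Complex.exp (2 * Real.pi * Complex.I / m)

namespace GMatrix

variable {m n : ℕ}

theorem xi_pow_self [NeZero m] : xi m ^ m = 1 :=
  (Complex.isPrimitiveRoot_exp m (NeZero.ne m)).pow_eq_one

theorem xi_ne_zero : xi m ≠ 0 := Complex.exp_ne_zero _

theorem xi_pow_val_add [NeZero m] (a b : ZMod m) :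
    xi m ^ (a + b).val = xi m ^ a.val * xi m ^ b.val := by
  rw [← pow_add, ZMod.val_add, ← pow_eq_pow_mod _ xi_pow_self]

/-- The monomial matrix encoded by `[u; g]`. -/
noncomputable def toMatrix [NeZero m] : GMatrix m n →* Matrix (Fin n) (Fin n) ℂ where
  toFun w := Matrix.of fun i k => if i = w.perm k then xi m ^ (w.color k).val else 0
  map_one' := by
    ext i k
    simp [Matrix.one_apply]
  map_mul' w z := by
    ext i k
    simp [Matrix.mul_apply, xi_pow_val_add]

theorem toMatrix_apply [NeZero m] (w : GMatrix m n) (i k : Fin n) :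
    toMatrix w i k = if i = w.perm k then xi m ^ (w.color k).val else 0 := rfl

/-- `[u; g]` is determined by its matrix. -/
theorem toMatrix_injective [NeZero m] : Function.Injective (toMatrix (m := m) (n := n)) := by
  intro w z h
  have key : ∀ i k, (if i = w.perm k then xi m ^ (w.color k).val else 0) =
      if i = z.perm k then xi m ^ (z.color k).val else 0 := fun i k => congrFun (congrFun h i) k
  have hp : ∀ k, w.perm k = z.perm k := by
    intro k
    have h1 := key (w.perm k) k
    by_contra hne
    rw [if_pos rfl, if_neg hne] at h1
    exact pow_ne_zero _ xi_ne_zero h1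
  refine GMatrix.ext (Equiv.ext hp) (funext fun k => ?_)
  have h1 := key (w.perm k) k
  rw [if_pos rfl, if_pos (hp k)] at h1
  exact ZMod.val_injective m ((Complex.isPrimitiveRoot_exp m (NeZero.ne m)).pow_inj
    (ZMod.val_lt _) (ZMod.val_lt _) h1)

/-- The matrices `[u; g]` are exactly the `n × n` monomial matrices whose nonzero entries are
`m`-th roots of unity. -/
theorem mem_range_toMatrix_iff [NeZero m] (A : Matrix (Fin n) (Fin n) ℂ) :
    A ∈ Set.range (toMatrix (m := m) (n := n)) ↔
      (∀ k, ∃! i, A i k ≠ 0) ∧ (∀ i, ∃! k, A i k ≠ 0) ∧ ∀ i k, A i k ≠ 0 → A i k ^ m = 1 := by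
  constructor
  · rintro ⟨w, rfl⟩
    have hx : ∀ a : ℕ, xi m ^ a ≠ 0 := fun a => pow_ne_zero _ xi_ne_zero
    refine ⟨fun k => ⟨w.perm k, ?_, ?_⟩, fun i => ⟨w.perm.symm i, ?_, ?_⟩, fun i k => ?_⟩
    · simp [toMatrix_apply, xi_ne_zero]
    · intro i hi
      by_contra hne
      exact hi (if_neg hne)
    · simp [toMatrix_apply, xi_ne_zero]
    · intro k hk
      by_contra hne
      exact hk (if_neg fun h => hne (by simp [h]))
    · intro h
      rw [toMatrix_apply] at h ⊢
      split_ifs at h ⊢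
      · rw [← pow_mul, mul_comm, pow_mul, xi_pow_self, one_pow]
      · exact absurd rfl h
  · rintro ⟨hc, hr, hroot⟩
    choose u hu hu' using hc
    have hinj : Function.Injective u := fun k l hkl =>
      (hr (u k)).unique (hu k) (by rw [hkl]; exact hu l)
    have hg : ∀ k, ∃ g : ZMod m, xi m ^ g.val = A (u k) k := by
      intro k
      obtain ⟨a, ha, hak⟩ := (Complex.isPrimitiveRoot_exp m (NeZero.ne m)).eq_pow_of_pow_eq_one
        (hroot _ _ (hu k))
      exact ⟨(a : ZMod m), by rw [ZMod.val_natCast, Nat.mod_eq_of_lt ha]; exact hak⟩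
    choose g hg using hg
    refine ⟨⟨Equiv.ofBijective u (Finite.injective_iff_bijective.1 hinj), g⟩, ?_⟩
    ext i k
    rw [toMatrix_apply]
    change (if i = u k then xi m ^ (g k).val else 0) = A i k
    split_ifs with h
    · rw [h, hg]
    · by_contra hne
      exact h (hu' k i (Ne.symm hne))

/-! Reflections -/

/-- The reflection `[(i j); 0,…,α,…,-α,…,0]` of order two (with `α` in position `i` and `-α` in
position `j`), fixing the hyperplane `x_j = ξ^α x_i`; used for `i ≠ j`. -/
def swapReflection (i j : Fin n) (α : ZMod m) : GMatrix m n :=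
  ⟨Equiv.swap i j, Pi.single i α + Pi.single j (-α)⟩

/-- The reflection `[id; 0,…,α,…,0]` (with `α` in position `i`), fixing the hyperplane `x_i = 0`;
used for `α ≠ 0`. -/
def diagReflection (i : Fin n) (α : ZMod m) : GMatrix m n :=
  ⟨1, Pi.single i α⟩

end GMatrix

/-! Colored partitions in multiplicity notation, and conjugacy classes -/

/-- A colored partition in multiplicity notation: `d (α, i)` is the number of parts of the
`α`-th partition that are equal to `i`. It is also the exponent vector of a monomial in the
variables `p_i^{(α)}`. -/
abbrev ColoredMult (m : ℕ) : Type := ZMod m × ℕ+ →₀ ℕ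

/-- The sum of all parts of all the partitions. -/
def ColoredMult.size {m : ℕ} (d : ColoredMult m) : ℕ := d.sum fun x c => c * (x.2 : ℕ)

/-- The supports of the cycles of a permutation, fixed points included. -/
noncomputable def cycleSupports {n : ℕ} (u : Equiv.Perm (Fin n)) : Finset (Finset (Fin n)) := by
  classical exact Finset.univ.image fun x => Finset.univ.filter fun y => u.SameCycle x y

/-- The colored partition of `[u; g]`: every cycle `O` of `u` contributes a part `|O|` to the
partition whose index is the cycle product `∑_{x ∈ O} g_x`. -/
noncomputable def GMatrix.type {m n : ℕ} (w : GMatrix m n) : ColoredMult m :=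
  ∑ O ∈ cycleSupports w.perm, Finsupp.single (∑ x ∈ O, w.color x, O.card.toPNat') 1

/-- The class `C_d` of all elements of `G(m,1,n)` whose colored partition is `d`. -/
noncomputable def conjClass {m : ℕ} [NeZero m] (n : ℕ) (d : ColoredMult m) :
    Finset (GMatrix m n) := by
  classical exact Finset.univ.filter fun w => w.type = d

/-- The normalized class sum `(1 / #C_d) ∑_{x ∈ C_d} x` in the group algebra. -/
noncomputable def classAverage {m : ℕ} [NeZero m] (n : ℕ) (d : ColoredMult m) :
    MonoidAlgebra ℂ (GMatrix m n) :=
  ((conjClass n d).card : ℂ)⁻¹ • ∑ x ∈ conjClass n d, MonoidAlgebra.of ℂ (GMatrix m n) x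

/-- The elements `𝒯_k`: for `k = 0` the sum of the reflections of order two exchanging two
coordinate axes, for `k ≠ 0` the sum of the diagonal reflections with entry `ξ^k`. -/
noncomputable def reflectionSum (m n : ℕ) [NeZero m] (k : ZMod m) :
    MonoidAlgebra ℂ (GMatrix m n) :=
  if k = 0 then
    ∑ i : Fin n, ∑ j ∈ Finset.Ioi i, ∑ α : ZMod m,
      MonoidAlgebra.of ℂ (GMatrix m n) (GMatrix.swapReflection i j α)
  else
    ∑ i : Fin n, MonoidAlgebra.of ℂ (GMatrix m n) (GMatrix.diagReflection i k)

/-! Cut-and-join operators -/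

/-- The polynomial ring `ℂ[p^{(0)}, …, p^{(m-1)}]`; the variable `(α, i)` is `p_i^{(α)}`. -/
abbrev PRing (m : ℕ) : Type := MvPolynomial (ZMod m × ℕ+) ℂ

/-- The linear map `Θ` from the group algebra to `ℂ[p]` sending every element of `C_d` to the
monomial `p_d`. On the center it is the linear map sending each normalized class sum to `p_d`. -/
noncomputable def theta (m n : ℕ) : MonoidAlgebra ℂ (GMatrix m n) →ₗ[ℂ] PRing m :=
  (Finsupp.linearCombination ℂ fun w : GMatrix m n => MvPolynomial.monomial w.type (1 : ℂ)) ∘ₗ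
    (MonoidAlgebra.coeffLinearEquiv ℂ : MonoidAlgebra ℂ (GMatrix m n) ≃ₗ[ℂ] _).toLinearMap

theorem theta_of (m n : ℕ) (w : GMatrix m n) :
    theta m n (MonoidAlgebra.of ℂ (GMatrix m n) w) = MvPolynomial.monomial w.type (1 : ℂ) := by
  simp [theta]

theorem theta_classAverage {m : ℕ} [NeZero m] (n : ℕ) (d : ColoredMult m)
    (h : (conjClass n d).Nonempty) :
    theta m n (classAverage n d) = MvPolynomial.monomial d (1 : ℂ) := by
  have h0 : ((conjClass n d).card : ℂ) ≠ 0 := by exact_mod_cast h.card_pos.ne'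
  have h1 : ∀ x ∈ conjClass n d, theta m n (MonoidAlgebra.of ℂ (GMatrix m n) x) =
      MvPolynomial.monomial d (1 : ℂ) := by
    intro x hx
    rw [theta_of]
    have : x.type = d := by simpa [conjClass] using hx
    rw [this]
  rw [classAverage, map_smul, map_sum, Finset.sum_congr rfl h1, Finset.sum_const,
    ← Nat.cast_smul_eq_nsmul ℂ, smul_smul, inv_mul_cancel₀ h0, one_smul]

/-- The cut-and-join operator `𝒞𝒥_k`: multiplication by `𝒯_k` on the span of the class sums of
the group algebras of the groups `G(m,1,n)`, transported by `Θ`. On the monomial `p_d`, where `d`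
has size `n`, it takes the value `Θ (𝒯_k * C_d)` with `C_d` the normalized class sum. -/
noncomputable def cutJoin (m : ℕ) [NeZero m] (k : ZMod m) : Module.End ℂ (PRing m) :=
  (MvPolynomial.basisMonomials (ZMod m × ℕ+) ℂ).constr ℂ fun d : ColoredMult m =>
    theta m d.size (reflectionSum m d.size k * classAverage d.size d)

/-! Schur polynomials -/

/-- The complete homogeneous polynomials in terms of power sums `x_1, x_2, …`, given by
`h_0 = 1` and `n h_n = ∑_{k=1}^n x_k h_{n-k}`; equivalently
`∑ h_n t^n = exp (∑_{k ≥ 1} x_k t^k / k)`. -/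
noncomputable def hPoly {A : Type*} [CommRing A] [Algebra ℂ A] (x : ℕ+ → A) : ℕ → A
  | 0 => 1
  | n + 1 => ((n : ℂ) + 1)⁻¹ • ∑ k : Fin (n + 1), x (Nat.succPNat k) * hPoly x (n - k)

/-- The Schur polynomial `s_μ(x_1, x_2, …)` in terms of power sums `x_1, x_2, …`, given by
`s_μ = det (h_{μ_i - i + j})`, where `h_r = 0` for `r < 0` and `i, j` run over the rows of `μ`. -/
noncomputable def schurPoly {A : Type*} [CommRing A] [Algebra ℂ A] (μ : YoungDiagram)
    (x : ℕ+ → A) : A :=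
  Matrix.det (Matrix.of fun i j : Fin (μ.colLen 0) =>
    if (i : ℕ) ≤ μ.rowLen i + j then hPoly x (μ.rowLen i + j - i) else 0)

/-- The variables `P_i^{(α)} = (1/m) ∑_β ξ^{-αβ} p_i^{(β)}`, the solution of
`p_i^{(α)} = ∑_β ξ^{αβ} P_i^{(β)}`. -/
noncomputable def fourierVar (m : ℕ) [NeZero m] (α : ZMod m) (i : ℕ+) : PRing m :=
  (m : ℂ)⁻¹ • ∑ β : ZMod m, ((xi m)⁻¹ ^ (α.val * β.val)) • MvPolynomial.X (β, i)

/-- `s_λ = ∏_α s_{λ_α}(P^{(α)})`. -/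
noncomputable def coloredSchur (m : ℕ) [NeZero m] (lam : ZMod m → YoungDiagram) : PRing m :=
  ∏ α : ZMod m, schurPoly (lam α) (fourierVar m α)

/-! Left multiplication by `[(i j); ..., α, ..., -α, ...]` either joins the two cycles through `i`
and `j` or cuts their common cycle in two. On monomials of cycle types, summing over all these
reflections therefore acts as a second order differential operator: its values on the variables
describe cuts, and its symbol, the biderivation `Γ`, describes joins
(`sum_monomial_type_swapReflection_mul`, `exists_isSecondOrder`, `cutJoin_zero_eq`). A diagonal
reflection only shifts the color of one cycle, so `𝒯_k` with `k ≠ 0` acts as a derivation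
(`cutJoin_eq_derivation`).

In both descriptions the colors combine by convolution on `ℤ/m`. The discrete Fourier transform to
the variables `P` diagonalizes this: `𝒞𝒥_0` becomes a sum of `m` operators in separate sets of
variables, each being `m` times the classical cut-and-join operator (`symbol_fourierVar`,
`isCutJoinSeq_fourierVar`), and `𝒞𝒥_k` becomes a degree operator weighted by `ξ^{kα}`
(`derivation_fourierVar`).

There remains the classical fact that Schur polynomials are eigenvectors of the cut-and-join
operator. It is proved on the Jacobi–Trudi determinant. The diagonal action on `h_n` comes from the
differential equation of `∑ h_n t^n` (`IsCutJoinSeq.map_hPoly`). The interaction of two columns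
comes from a recurrence for `Γ (h_a, h_b)` (`IsCutJoinSeq.join_recurrence`), which telescopes inside
the determinant because determinants with repeated columns vanish (`IsCutJoinSeq.detPair_of_lt`).
For nonvanishing, specialize `P_1 = 1` and the other `P_i = 0`; the determinant becomes a
Vandermonde determinant up to nonzero factors. -/

/-! Second order differential operators -/

section SecondOrder

variable {A : Type*} [CommRing A] [Algebra ℂ A]

/-- `L` is a differential operator of order at most two, whose failure to be a derivation is
measured by the symmetric biderivation `Γ`. -/
structure IsSecondOrder (L : A →ₗ[ℂ] A) (Γ : A →ₗ[ℂ] Derivation ℂ A A) : Prop where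
  map_mul : ∀ f g, L (f * g) = f * L g + g * L f + Γ f g
  symm : ∀ f g, Γ f g = Γ g f

theorem IsSecondOrder.map_one {L : A →ₗ[ℂ] A} {Γ : A →ₗ[ℂ] Derivation ℂ A A}
    (h : IsSecondOrder L Γ) : L 1 = 0 := by
  have := h.map_mul 1 1
  simpa using this

theorem Derivation.map_prod' {ι : Type*} [DecidableEq ι] (D : Derivation ℂ A A) (s : Finset ι)
    (f : ι → A) : D (∏ i ∈ s, f i) = ∑ i ∈ s, D (f i) * ∏ j ∈ s.erase i, f j := by
  induction s using Finset.induction_on with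
  | empty => simp
  | insert a s ha ih =>
    rw [Finset.prod_insert ha, D.leibniz, ih, Finset.sum_insert ha, Finset.erase_insert ha,
      smul_eq_mul, smul_eq_mul, Finset.mul_sum, add_comm, mul_comm (D (f a))]
    congr 1
    refine Finset.sum_congr rfl fun i hi => ?_
    have hia : i ≠ a := fun h => ha (h ▸ hi)
    rw [Finset.erase_insert_of_ne hia.symm, Finset.prod_insert (by simp [ha])]
    ring

/-- A second order operator sees at most two factors at a time. The coefficient `1/2` compensates
for counting every unordered pair of factors twice. -/
theorem IsSecondOrder.map_prod {ι : Type*} [DecidableEq ι] {L : A →ₗ[ℂ] A}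
    {Γ : A →ₗ[ℂ] Derivation ℂ A A} (h : IsSecondOrder L Γ) (s : Finset ι) (f : ι → A) :
    L (∏ i ∈ s, f i) = ∑ i ∈ s, L (f i) * ∏ j ∈ s.erase i, f j +
      (2⁻¹ : ℂ) • ∑ i ∈ s, ∑ j ∈ s.erase i,
        Γ (f i) (f j) * ∏ k ∈ (s.erase i).erase j, f k := by
  induction s using Finset.induction_on with
  | empty => simp [h.map_one]
  | insert a s ha ih =>
    have hne : ∀ i ∈ s, a ≠ i := fun i hi h => ha (h ▸ hi)
    have h1 : ∑ i ∈ s, L (f i) * ∏ j ∈ (insert a s).erase i, f j =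
        f a * ∑ i ∈ s, L (f i) * ∏ j ∈ s.erase i, f j := by
      rw [Finset.mul_sum]
      refine Finset.sum_congr rfl fun i hi => ?_
      rw [Finset.erase_insert_of_ne (hne i hi), Finset.prod_insert (by simp [ha])]
      ring
    have h2 : ∑ i ∈ s, ∑ j ∈ (insert a s).erase i,
        Γ (f i) (f j) * ∏ k ∈ ((insert a s).erase i).erase j, f k =
        Γ (f a) (∏ j ∈ s, f j) + f a * ∑ i ∈ s, ∑ j ∈ s.erase i,
        Γ (f i) (f j) * ∏ k ∈ (s.erase i).erase j, f k := by
      rw [Derivation.map_prod', Finset.mul_sum, ← Finset.sum_add_distrib]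
      refine Finset.sum_congr rfl fun i hi => ?_
      have ha' : a ∉ s.erase i := by simp [ha]
      rw [Finset.erase_insert_of_ne (hne i hi), Finset.sum_insert ha', Finset.erase_insert ha',
        h.symm (f i) (f a), Finset.mul_sum]
      congr 1
      refine Finset.sum_congr rfl fun j hj => ?_
      have hj' : a ≠ j := hne j (Finset.mem_of_mem_erase hj)
      rw [Finset.erase_insert_of_ne hj', Finset.prod_insert (by simp [ha])]
      ring
    rw [Finset.prod_insert ha, h.map_mul, ih, Finset.sum_insert ha, Finset.erase_insert ha,
      Finset.sum_insert ha, h1, h2, Finset.erase_insert ha, ← Derivation.map_prod', smul_add,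
      smul_add, mul_add, mul_smul_comm]
    -- The cross terms of `f a` with the older factors occur once with `a` as first index and once
    -- as second; the two halves add up to the single `Γ` of the product rule.
    have h3 : Γ (f a) (∏ j ∈ s, f j) =
        (2⁻¹ : ℂ) • Γ (f a) (∏ j ∈ s, f j) + (2⁻¹ : ℂ) • Γ (f a) (∏ j ∈ s, f j) := by
      rw [← add_smul]; norm_num
    linear_combination h3

end SecondOrder

/-! Complete homogeneous polynomials in terms of power sums -/

section Homogeneous

open PowerSeries

variable {A : Type*} [CommRing A]

/-- The sequence `0, x_1, x_2, …`. -/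
def extendZero (x : ℕ+ → A) (n : ℕ) : A := if h : 0 < n then x ⟨n, h⟩ else 0

@[simp] theorem extendZero_zero (x : ℕ+ → A) : extendZero x 0 = 0 := rfl

theorem extendZero_coe (x : ℕ+ → A) (n : ℕ+) : extendZero x n = x n :=
  dif_pos n.pos

variable [Algebra ℂ A]

@[simp] theorem hPoly_zero (x : ℕ+ → A) : hPoly x 0 = 1 := by rw [hPoly]

theorem natCast_smul_hPoly (x : ℕ+ → A) (n : ℕ) :
    (n : ℂ) • hPoly x n =
      ∑ ij ∈ Finset.HasAntidiagonal.antidiagonal n, extendZero x ij.1 * hPoly x ij.2 := by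
  cases n with
  | zero => simp
  | succ n =>
    rw [hPoly, smul_smul, Nat.cast_succ, mul_inv_cancel₀ (Nat.cast_add_one_ne_zero n), one_smul,
      Finset.Nat.sum_antidiagonal_eq_sum_range_succ_mk, Finset.sum_range_succ',
      extendZero_zero, zero_mul, add_zero, Finset.sum_range]
    refine Finset.sum_congr rfl fun k _ => ?_
    rw [Nat.add_sub_add_right]
    simp [extendZero, Nat.succPNat]

/-- The Euler operator `t d/dt` on power series. -/
noncomputable def euler : Derivation A A⟦X⟧ A⟦X⟧ := (X : A⟦X⟧) • PowerSeries.derivative A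

theorem coeff_euler (f : A⟦X⟧) (n : ℕ) : coeff n (euler f) = (n : ℂ) • coeff n f := by
  rw [euler, Derivation.smul_apply, smul_eq_mul]
  cases n with
  | zero => simp
  | succ n =>
    rw [coeff_succ_X_mul, coeff_derivative, Algebra.smul_def]
    simp [mul_comm]

/-- Apply an additive map to all coefficients. -/
noncomputable def mapCoeff (f : A →ₗ[ℂ] A) (φ : A⟦X⟧) : A⟦X⟧ := PowerSeries.mk fun n => f (coeff n φ)

@[simp] theorem coeff_mapCoeff (f : A →ₗ[ℂ] A) (φ : A⟦X⟧) (n : ℕ) :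
    coeff n (mapCoeff f φ) = f (coeff n φ) := coeff_mk _ _

theorem euler_mapCoeff (f : A →ₗ[ℂ] A) (φ : A⟦X⟧) :
    euler (mapCoeff f φ) = mapCoeff f (euler φ) := by
  ext n
  simp [coeff_euler]

theorem mapCoeff_derivation_mul (D : Derivation ℂ A A) (φ ψ : A⟦X⟧) :
    mapCoeff (D : A →ₗ[ℂ] A) (φ * ψ) = mapCoeff (D : A →ₗ[ℂ] A) φ * ψ +
      φ * mapCoeff (D : A →ₗ[ℂ] A) ψ := by
  ext n
  simp only [coeff_mapCoeff, coeff_mul, map_sum, map_add, ← Finset.sum_add_distrib,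
    Derivation.coeFn_coe, Derivation.leibniz, smul_eq_mul]
  exact Finset.sum_congr rfl fun _ _ => by ring

/-- The generating series `∑ x_n t^n`. -/
noncomputable def powerSeriesP (x : ℕ+ → A) : A⟦X⟧ := PowerSeries.mk (extendZero x)

/-- The generating series `∑ h_n t^n`. -/
noncomputable def powerSeriesH (x : ℕ+ → A) : A⟦X⟧ := PowerSeries.mk (hPoly x)

/-- Newton's identities, read as the equation `t H' = P H` that replaces the exponential formula for
`H`. -/
theorem euler_powerSeriesH (x : ℕ+ → A) :
    euler (powerSeriesH x) = powerSeriesP x * powerSeriesH x := by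
  ext n
  rw [coeff_euler, coeff_mul, powerSeriesH, coeff_mk, natCast_smul_hPoly]
  simp [powerSeriesP]

/-- Uniqueness for `t Z' = P Z`: since `P` has no constant term, coefficient `n` of the equation
expresses `n z_n` through earlier coefficients. It serves in place of logarithms of power series. -/
theorem eq_zero_of_euler_eq (x : ℕ+ → A) (Z : A⟦X⟧) (h0 : coeff 0 Z = 0)
    (h : euler Z = powerSeriesP x * Z) : Z = 0 := by
  have key : ∀ n, coeff n Z = 0 := by
    intro n
    induction n using Nat.strong_induction_on with
    | _ n ih =>
      rcases Nat.eq_zero_or_pos n with rfl | hn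
      · exact h0
      · have h1 := congrArg (coeff n) h
        rw [coeff_euler, coeff_mul, Finset.sum_eq_zero] at h1
        · exact (smul_eq_zero.1 h1).resolve_left (by exact_mod_cast hn.ne')
        · rintro ⟨i, j⟩ hij
          rw [Finset.HasAntidiagonal.mem_antidiagonal] at hij
          simp only at hij ⊢
          rcases Nat.eq_zero_or_pos i with rfl | hi
          · simp [powerSeriesP]
          · rw [ih j (by omega), mul_zero]
  ext n
  simp [key]

/-- Logarithmic differentiation: formally `log H = ∑ x_n t^n / n`, hence `D H = D (log H) * H`. The
difference of the two sides solves `t Z' = P Z` with constant term zero. -/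
theorem mapCoeff_derivation_powerSeriesH (x : ℕ+ → A) (D : Derivation ℂ A A) :
    mapCoeff (D : A →ₗ[ℂ] A) (powerSeriesH x) =
      PowerSeries.mk (fun n : ℕ => (n : ℂ)⁻¹ • D (extendZero x n)) * powerSeriesH x := by
  set Q : A⟦X⟧ := PowerSeries.mk (fun n : ℕ => (n : ℂ)⁻¹ • D (extendZero x n)) with hQ
  have hQ' : euler Q = mapCoeff (D : A →ₗ[ℂ] A) (powerSeriesP x) := by
    ext n
    rw [coeff_euler, hQ, coeff_mk, coeff_mapCoeff, powerSeriesP, coeff_mk, smul_smul]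
    rcases Nat.eq_zero_or_pos n with rfl | hn
    · simp
    · rw [mul_inv_cancel₀ (by exact_mod_cast hn.ne'), one_smul]; rfl
  rw [← sub_eq_zero]
  refine eq_zero_of_euler_eq x _ ?_ ?_
  · rw [map_sub, coeff_mapCoeff]
    simp [powerSeriesH, coeff_mul, hQ]
  · rw [map_sub, euler_mapCoeff, euler_powerSeriesH, mapCoeff_derivation_mul, Derivation.leibniz,
      hQ', euler_powerSeriesH]
    simp only [smul_eq_mul]
    ring

theorem derivation_hPoly (x : ℕ+ → A) (D : Derivation ℂ A A) (n : ℕ) :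
    D (hPoly x n) = ∑ ij ∈ Finset.HasAntidiagonal.antidiagonal n,
      ((ij.1 : ℂ)⁻¹ • D (extendZero x ij.1)) * hPoly x ij.2 := by
  have := congrArg (coeff n) (mapCoeff_derivation_powerSeriesH x D)
  simpa [coeff_mul, powerSeriesH] using this

/-! ### Cut-and-join relations and the complete homogeneous polynomials -/

/-- The sequence `x` satisfies the cut-and-join relations with constant `c` for the operator `L`
with symbol `Γ`. -/
structure IsCutJoinSeq (L : A →ₗ[ℂ] A) (Γ : A →ₗ[ℂ] Derivation ℂ A A) (c : ℂ) (x : ℕ+ → A) :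
    Prop where
  cut : ∀ n : ℕ+, L (x n) = (c * n / 2) •
    ∑ ij ∈ Finset.HasAntidiagonal.antidiagonal (n : ℕ), extendZero x ij.1 * extendZero x ij.2
  join : ∀ a b : ℕ+, Γ (x a) (x b) = (c * a * b) • x (a + b)

variable {L : A →ₗ[ℂ] A} {Γ : A →ₗ[ℂ] Derivation ℂ A A} {c : ℂ} {x : ℕ+ → A}

theorem IsCutJoinSeq.cut_extendZero (h : IsCutJoinSeq L Γ c x) (n : ℕ) :
    L (extendZero x n) = (c * n / 2) •
      ∑ ij ∈ Finset.HasAntidiagonal.antidiagonal n, extendZero x ij.1 * extendZero x ij.2 := by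
  rcases Nat.eq_zero_or_pos n with rfl | hn
  · simp
  · exact (congrArg L (extendZero_coe x ⟨n, hn⟩)).trans (h.cut ⟨n, hn⟩)

theorem IsCutJoinSeq.join_extendZero (h : IsCutJoinSeq L Γ c x) (a b : ℕ) :
    Γ (extendZero x a) (extendZero x b) = (c * a * b) • extendZero x (a + b) := by
  rcases Nat.eq_zero_or_pos a with rfl | ha
  · simp
  rcases Nat.eq_zero_or_pos b with rfl | hb
  · simp
  lift a to ℕ+ using ha
  lift b to ℕ+ using hb
  rw [← PNat.add_coe, extendZero_coe, extendZero_coe, extendZero_coe, h.join]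

/-- The pair with second entry `0` is left out because `derivation_hPoly` gives it the weight `0⁻¹ =
0`. -/
theorem sum_antidiagonal_fst_offset (n : ℕ) :
    ∑ ij ∈ Finset.HasAntidiagonal.antidiagonal n, (if ij.2 = 0 then 0 else (ij.1 : ℂ)) = n * (n - 1) / 2 := by
  rw [Finset.Nat.sum_antidiagonal_eq_sum_range_succ_mk, Finset.sum_range_succ]
  simp only [Nat.sub_self, if_true, add_zero]
  have : ∀ k ∈ Finset.range n, (if n - k = 0 then (0 : ℂ) else (k : ℂ)) = k := by
    intro k hk
    rw [Finset.mem_range] at hk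
    rw [if_neg (by omega)]
  rw [Finset.sum_congr rfl this]
  clear this
  induction n with
  | zero => simp
  | succ n ih => rw [Finset.sum_range_succ, ih]; push_cast; ring

/-- Write `θ` for `t d/dt`. Applying `L` to `θ H = P H` shows that `L H` and `(c/2) (θP + P² - P) H`
satisfy the same first order equation, up to a solution of `θ Z = P Z` without constant term, which
is zero. Since `θ² H = (θP + P²) H`, the result is `(c/2) (θ² - θ) H`, with coefficients `c n(n-1)/2
h_n`. -/
theorem IsCutJoinSeq.map_hPoly (hL : IsSecondOrder L Γ) (h : IsCutJoinSeq L Γ c x) (n : ℕ) :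
    L (hPoly x n) = (c * (n * (n - 1) / 2)) • hPoly x n := by
  set P := powerSeriesP x with hP
  set H := powerSeriesH x with hH
  have hθP : ∀ n, coeff n P = extendZero x n := fun n => coeff_mk _ _
  have hcH : ∀ n, coeff n H = hPoly x n := fun n => coeff_mk _ _
  -- The cross term in `L (P H)`: each `Γ (x_i)` is a derivation, so its effect on `H` is
  -- multiplication by a series with coefficients `j⁻¹ Γ (x_i, x_j) = c i x_{i+j}` for `j > 0`.
  have hS : (PowerSeries.mk fun n => ∑ ij ∈ Finset.HasAntidiagonal.antidiagonal n,
      Γ (extendZero x ij.1) (hPoly x ij.2)) =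
      (c / 2) • (euler (euler P) - euler P) * H := by
    have hB : (c / 2) • (euler (euler P) - euler P) = PowerSeries.mk fun n =>
        ∑ ij ∈ Finset.HasAntidiagonal.antidiagonal n,
          (ij.2 : ℂ)⁻¹ • Γ (extendZero x ij.1) (extendZero x ij.2) := by
      ext n
      rw [coeff_mk, coeff_smul, map_sub, coeff_euler, coeff_euler, hθP, smul_smul, ← sub_smul,
        smul_smul]
      have : ∀ ij ∈ Finset.HasAntidiagonal.antidiagonal n,
          (ij.2 : ℂ)⁻¹ • Γ (extendZero x ij.1) (extendZero x ij.2) =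
          (c * if ij.2 = 0 then 0 else (ij.1 : ℂ)) • extendZero x n := by
        rintro ⟨i, j⟩ hij
        rw [Finset.HasAntidiagonal.mem_antidiagonal] at hij
        simp only at hij ⊢
        rw [h.join_extendZero, hij, smul_smul]
        split_ifs with hj
        · simp [hj]
        · have : (j : ℂ) ≠ 0 := by exact_mod_cast hj
          congr 1
          field_simp
      rw [Finset.sum_congr rfl this, ← Finset.sum_smul, ← Finset.mul_sum,
        sum_antidiagonal_fst_offset]
      congr 1
      ring
    rw [hB]
    ext n
    simp only [coeff_mk, coeff_mul, hcH, derivation_hPoly, Finset.sum_mul]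
    rw [Finset.sum_sigma', Finset.sum_sigma']
    refine Finset.sum_nbij' (fun p => ⟨(p.1.1 + p.2.1, p.2.2), (p.1.1, p.2.1)⟩)
      (fun p => ⟨(p.2.1, p.2.2 + p.1.2), (p.2.2, p.1.2)⟩) ?_ ?_ ?_ ?_ ?_
    · rintro ⟨⟨i, j⟩, ⟨k, l⟩⟩ hp
      simp only [Finset.mem_sigma, Finset.HasAntidiagonal.mem_antidiagonal] at hp ⊢
      exact ⟨by omega, trivial⟩
    · rintro ⟨⟨i, j⟩, ⟨k, l⟩⟩ hp
      simp only [Finset.mem_sigma, Finset.HasAntidiagonal.mem_antidiagonal] at hp ⊢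
      exact ⟨by omega, trivial⟩
    · rintro ⟨⟨i, j⟩, ⟨k, l⟩⟩ hp
      simp only [Finset.mem_sigma, Finset.HasAntidiagonal.mem_antidiagonal] at hp
      obtain ⟨h1, h2⟩ := hp
      subst h2
      rfl
    · rintro ⟨⟨i, j⟩, ⟨k, l⟩⟩ hp
      simp only [Finset.mem_sigma, Finset.HasAntidiagonal.mem_antidiagonal] at hp
      obtain ⟨h1, h2⟩ := hp
      subst h2
      rfl
    · rintro ⟨⟨i, j⟩, ⟨k, l⟩⟩ hp
      rfl
  have hPH : mapCoeff L (P * H) = mapCoeff L P * H + P * mapCoeff L H +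
      (c / 2) • (euler (euler P) - euler P) * H := by
    rw [← hS]
    ext n
    simp only [coeff_mapCoeff, coeff_mul, map_sum, map_add, ← Finset.sum_add_distrib, coeff_mk,
      hθP, hcH]
    refine Finset.sum_congr rfl fun _ _ => ?_
    rw [hL.map_mul]
    ring
  have hLP : mapCoeff L P = (c / 2) • euler (P * P) := by
    ext n
    rw [coeff_mapCoeff, hθP, h.cut_extendZero, coeff_smul, coeff_euler, smul_smul, coeff_mul]
    simp only [hθP]
    congr 1
    ring
  have main : mapCoeff L H - (c / 2) • (euler P + P * P - P) * H = 0 := by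
    refine eq_zero_of_euler_eq x _ ?_ ?_
    · rw [map_sub, coeff_mapCoeff, hcH, hPoly_zero, hL.map_one, smul_mul_assoc, coeff_smul,
        coeff_mul]
      simp [-coeff_zero_eq_constantCoeff, coeff_euler, hθP, coeff_mul]
    · have hs : ∀ f : A⟦X⟧, euler ((c / 2) • f) = (c / 2) • euler f := by
        intro f; ext n; simp only [coeff_euler, coeff_smul]; rw [smul_comm]
      have hθH : euler H = P * H := euler_powerSeriesH x
      rw [map_sub, euler_mapCoeff, hθH, hPH, hLP]
      simp only [smul_mul_assoc, hs, Derivation.leibniz, hθH, map_sub, map_add]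
      simp only [smul_eq_mul, Algebra.smul_def, ← hP]
      ring
  have hHH : (c / 2) • (euler P + P * P - P) * H = (c / 2) • (euler (euler H) - euler H) := by
    rw [euler_powerSeriesH, Derivation.leibniz, euler_powerSeriesH]
    simp only [smul_eq_mul, Algebra.smul_def, ← hP, ← hH]
    ring
  have := congrArg (coeff n) (sub_eq_zero.1 main)
  rw [hHH, coeff_mapCoeff, hcH, coeff_smul, map_sub, coeff_euler, coeff_euler, hcH, smul_smul,
    ← sub_smul, smul_smul] at this
  rw [this]
  congr 1
  ring

/-- The complete homogeneous polynomials `h_r` for integers `r`, with `h_r = 0` for `r < 0`. -/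
noncomputable def hInt (x : ℕ+ → A) (r : ℤ) : A := if 0 ≤ r then hPoly x r.toNat else 0

theorem hInt_natCast (x : ℕ+ → A) (n : ℕ) : hInt x n = hPoly x n := by simp [hInt]

theorem hInt_of_neg (x : ℕ+ → A) {r : ℤ} (h : r < 0) : hInt x r = 0 := if_neg (not_le.2 h)

/-- With `h_r = 0` for `r < 0` the summation range can be any sufficiently long one, so that sums
belonging to different indices can be compared term by term. -/
theorem sum_antidiagonal_mul_hPoly (x : ℕ+ → A) (F : ℕ → A) (hF : F 0 = 0) (n N : ℕ)
    (hN : n ≤ N) :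
    ∑ ij ∈ Finset.HasAntidiagonal.antidiagonal n, F ij.1 * hPoly x ij.2 =
      ∑ k ∈ Finset.range N, F (k + 1) * hInt x ((n : ℤ) - 1 - k) := by
  rw [Finset.Nat.sum_antidiagonal_eq_sum_range_succ_mk, Finset.sum_range_succ', hF, zero_mul,
    add_zero]
  refine Finset.sum_subset_zero_on_sdiff (by simpa using hN) ?_ ?_
  · intro k hk
    simp only [Finset.mem_sdiff, Finset.mem_range] at hk
    rw [hInt_of_neg x (by omega), mul_zero]
  · intro k hk
    rw [Finset.mem_range] at hk
    rw [← hInt_natCast]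
    congr 2
    omega

theorem derivation_hInt (x : ℕ+ → A) (D : Derivation ℂ A A) (r : ℤ) (N : ℕ) (hN : r ≤ N) :
    D (hInt x r) = ∑ k ∈ Finset.range N,
      (((k : ℂ) + 1)⁻¹ • D (extendZero x (k + 1))) * hInt x (r - 1 - k) := by
  rcases lt_or_ge r 0 with hr | hr
  · rw [hInt_of_neg x hr, map_zero, Finset.sum_eq_zero]
    intro k _
    rw [hInt_of_neg x (by omega), mul_zero]
  · lift r to ℕ using hr
    rw [hInt_natCast, derivation_hPoly, sum_antidiagonal_mul_hPoly x
      (fun n => (n : ℂ)⁻¹ • D (extendZero x n)) (by simp) r N (by exact_mod_cast hN)]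
    push_cast
    rfl

theorem intCast_smul_hInt (x : ℕ+ → A) (r : ℤ) (N : ℕ) (hN : r ≤ N) :
    (r : ℂ) • hInt x r = ∑ k ∈ Finset.range N, extendZero x (k + 1) * hInt x (r - 1 - k) := by
  rcases lt_or_ge r 0 with hr | hr
  · rw [hInt_of_neg x hr, smul_zero, Finset.sum_eq_zero]
    intro k _
    rw [hInt_of_neg x (by omega), mul_zero]
  · lift r to ℕ using hr
    rw [hInt_natCast, Int.cast_natCast, natCast_smul_hPoly, sum_antidiagonal_mul_hPoly x
      (extendZero x) (by simp) r N (by exact_mod_cast hN)]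

/-- Such a `D` is `c` times the degree operator on the `x_n`, and `h_r` is homogeneous of degree
`r`. -/
theorem derivation_hInt_of_eigen (x : ℕ+ → A) (D : Derivation ℂ A A) (c : ℂ)
    (hD : ∀ n : ℕ+, D (x n) = (c * n) • x n) (r : ℤ) :
    D (hInt x r) = (c * r) • hInt x r := by
  rw [derivation_hInt x D r r.toNat (Int.self_le_toNat r), mul_smul,
    intCast_smul_hInt x r r.toNat (Int.self_le_toNat r), Finset.smul_sum]
  refine Finset.sum_congr rfl fun k _ => ?_
  have h1 : extendZero x (k + 1) = x (Nat.succPNat k) := extendZero_coe x (Nat.succPNat k)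
  have h2 : (k : ℂ) + 1 ≠ 0 := Nat.cast_add_one_ne_zero k
  rw [h1, hD, smul_smul, ← smul_mul_assoc]
  congr 2
  rw [Nat.succPNat_coe, Nat.cast_succ]
  field_simp

theorem IsCutJoinSeq.map_hInt (hL : IsSecondOrder L Γ) (h : IsCutJoinSeq L Γ c x) (r : ℤ) :
    L (hInt x r) = (c * (r * (r - 1) / 2)) • hInt x r := by
  rcases lt_or_ge r 0 with hr | hr
  · rw [hInt_of_neg x hr, map_zero, smul_zero]
  · lift r to ℕ using hr
    rw [hInt_natCast, h.map_hPoly hL, Int.cast_natCast]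

/-- The factors `k+1` and `l+1` of the join relation cancel the denominators of `∂ h_r / ∂ x_k =
h_{r-k} / k`; only a plain double sum survives. -/
theorem IsCutJoinSeq.join_hInt (hL : IsSecondOrder L Γ) (h : IsCutJoinSeq L Γ c x) (a b : ℤ)
    (N : ℕ) (ha : a ≤ N) (hb : b ≤ N) :
    Γ (hInt x a) (hInt x b) = c • ∑ k ∈ Finset.range N, ∑ l ∈ Finset.range N,
      extendZero x (k + l + 2) * hInt x (a - 1 - k) * hInt x (b - 1 - l) := by
  rw [derivation_hInt x _ b N hb, Finset.sum_comm, Finset.smul_sum]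
  refine Finset.sum_congr rfl fun l _ => ?_
  rw [hL.symm, derivation_hInt x _ a N ha, Finset.smul_sum, Finset.smul_sum, Finset.sum_mul]
  refine Finset.sum_congr rfl fun k _ => ?_
  rw [hL.symm, h.join_extendZero, smul_smul, smul_mul_assoc, smul_mul_assoc, smul_mul_assoc, smul_smul]
  have h1 : (k : ℂ) + 1 ≠ 0 := Nat.cast_add_one_ne_zero k
  have h2 : (l : ℂ) + 1 ≠ 0 := Nat.cast_add_one_ne_zero l
  rw [show k + 1 + (l + 1) = k + l + 2 by ring]
  congr 1
  push_cast
  field_simp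

/-- By `join_hInt` both symbols are sums of the same array `f k l = x_{k+l+1} h_{a-k} h_{b-l}`,
shifted by one in `k` and in `l` respectively. Their difference consists of the two boundary lines
`l = 0` and `k = 0`, which Newton's identities evaluate. -/
theorem IsCutJoinSeq.join_recurrence (hL : IsSecondOrder L Γ) (h : IsCutJoinSeq L Γ c x)
    (a b : ℤ) :
    Γ (hInt x a) (hInt x (b + 1)) - Γ (hInt x (a + 1)) (hInt x b) =
      c • (((a + 1 : ℂ) • hInt x (a + 1)) * hInt x b - hInt x a * ((b + 1 : ℂ) • hInt x (b + 1))) := by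
  obtain ⟨N, hNa, hNb⟩ : ∃ N : ℕ, a + 1 ≤ N ∧ b + 1 ≤ N :=
    ⟨(max (a + 1) (b + 1)).toNat, by omega, by omega⟩
  have ea := intCast_smul_hInt x (a + 1) N hNa
  have eb := intCast_smul_hInt x (b + 1) N hNb
  push_cast at ea eb
  rw [h.join_hInt hL a (b + 1) N (by omega) hNb, h.join_hInt hL (a + 1) b N hNa (by omega), ea, eb,
    ← smul_sub]
  congr 1
  set f : ℕ → ℕ → A := fun k l => extendZero x (k + l + 1) * hInt x (a - k) * hInt x (b - l) with hf
  have h1 : ∀ k l : ℕ, extendZero x (k + l + 2) * hInt x (a - 1 - k) * hInt x (b + 1 - 1 - l) =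
      f (k + 1) l := by
    intro k l
    simp only [hf]
    rw [show k + 1 + l + 1 = k + l + 2 by ring]
    push_cast
    rw [show a - 1 - (k : ℤ) = a - (k + 1) by ring, show b + 1 - 1 - (l : ℤ) = b - l by ring]
  have h2 : ∀ k l : ℕ, extendZero x (k + l + 2) * hInt x (a + 1 - 1 - k) * hInt x (b - 1 - l) =
      f k (l + 1) := by
    intro k l
    simp only [hf]
    rw [show k + (l + 1) + 1 = k + l + 2 by ring]
    push_cast
    rw [show a + 1 - 1 - (k : ℤ) = a - k by ring, show b - 1 - (l : ℤ) = b - (l + 1) by ring]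
  have h3 : ∀ l, ∑ k ∈ Finset.range N, f (k + 1) l = ∑ k ∈ Finset.range N, f k l - f 0 l := by
    intro l
    have e := Finset.sum_range_succ' (fun k => f k l) N
    rw [Finset.sum_range_succ] at e
    -- The far boundary contributes nothing because `a < N` makes the index of `h` negative.
    have : f N l = 0 := by
      simp only [hf]; rw [hInt_of_neg x (by omega : a - N < 0)]; ring
    rw [this] at e
    linear_combination -e
  have h4 : ∀ k, ∑ l ∈ Finset.range N, f k (l + 1) = ∑ l ∈ Finset.range N, f k l - f k 0 := by
    intro k
    have e := Finset.sum_range_succ' (fun l => f k l) N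
    rw [Finset.sum_range_succ] at e
    have : f k N = 0 := by
      simp only [hf]; rw [hInt_of_neg x (by omega : b - N < 0)]; ring
    rw [this] at e
    linear_combination -e
  simp only [h1, h2]
  rw [Finset.sum_comm]
  simp only [h3, h4, Finset.sum_sub_distrib]
  rw [Finset.sum_comm, Finset.sum_mul, Finset.mul_sum, sub_sub_sub_cancel_left]
  congr 1
  · refine Finset.sum_congr rfl fun k _ => ?_
    simp only [hf]
    rw [show a + 1 - 1 - (k : ℤ) = a - k by ring]
    simp
  · refine Finset.sum_congr rfl fun l _ => ?_
    simp only [hf]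
    rw [show b + 1 - 1 - (l : ℤ) = b - l by ring]
    simp only [zero_add, Nat.cast_zero, sub_zero]
    ring

end Homogeneous

/-! Second order operators on determinants -/

section Determinant

variable {A : Type*} [CommRing A] [Algebra ℂ A] {ι : Type*} [Fintype ι] [DecidableEq ι]

/-- The determinant of `M` in which the pair of columns `p`, `q` is replaced by the tensor `T`. -/
def detPair (M : Matrix ι ι A) (p q : ι) (T : ι → ι → A) : A :=
  ∑ σ : Equiv.Perm ι, Equiv.Perm.sign σ •
    (T (σ p) (σ q) * ∏ k ∈ (Finset.univ.erase p).erase q, M (σ k) k)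

omit [Algebra ℂ A] in
theorem detPair_sub (M : Matrix ι ι A) (p q : ι) (T U : ι → ι → A) :
    detPair M p q T - detPair M p q U = detPair M p q (fun i j => T i j - U i j) := by
  simp only [detPair, ← Finset.sum_sub_distrib, ← smul_sub, sub_mul]

theorem smul_detPair (M : Matrix ι ι A) (p q : ι) (c : ℂ) (T : ι → ι → A) :
    c • detPair M p q T = detPair M p q (fun i j => c • T i j) := by
  simp only [detPair, Finset.smul_sum, smul_mul_assoc]
  exact Finset.sum_congr rfl fun σ _ => smul_comm _ _ _

omit [Algebra ℂ A] in
theorem detPair_comm (M : Matrix ι ι A) (p q : ι) (T : ι → ι → A) :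
    detPair M p q T = detPair M q p (fun i j => T j i) := by
  simp only [detPair, Finset.erase_right_comm]

omit [Algebra ℂ A] in
-- Replace `σ` by `σ * swap p q`; the untouched columns do not notice.
theorem detPair_swap (M : Matrix ι ι A) {p q : ι} (hpq : p ≠ q) (T : ι → ι → A) :
    detPair M p q (fun i j => T j i) = -detPair M p q T := by
  rw [detPair, detPair, ← Finset.sum_neg_distrib,
    ← Equiv.sum_comp (Equiv.mulRight (Equiv.swap p q))]
  refine Finset.sum_congr rfl fun σ _ => ?_
  rw [Equiv.coe_mulRight, Equiv.Perm.sign_mul, Equiv.Perm.sign_swap hpq, mul_neg_one, Units.neg_smul]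
  congr 2
  simp only [Equiv.Perm.mul_apply, Equiv.swap_apply_left, Equiv.swap_apply_right]
  congr 1
  refine Finset.prod_congr rfl fun k hk => ?_
  simp only [Finset.mem_erase, Finset.mem_univ, and_true] at hk
  rw [Equiv.swap_apply_of_ne_of_ne hk.2 hk.1]

/-- Column `r` of `M` appears twice, once in the tensor and once among the remaining columns, so
composing `σ` with `swap q r` changes the sign of the sum. -/
theorem detPair_eq_zero_right (M : Matrix ι ι A) {p q r : ι} (hpq : p ≠ q) (hp : r ≠ p)
    (hq : r ≠ q) (v : ι → A) : detPair M p q (fun i j => v i * M j r) = 0 := by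
  have key : detPair M p q (fun i j => v i * M j r) = -detPair M p q (fun i j => v i * M j r) := by
    rw [detPair, ← Finset.sum_neg_distrib, ← Equiv.sum_comp (Equiv.mulRight (Equiv.swap q r))]
    refine Finset.sum_congr rfl fun σ _ => ?_
    rw [Equiv.coe_mulRight, Equiv.Perm.sign_mul, Equiv.Perm.sign_swap hq.symm, mul_neg_one,
      Units.neg_smul]
    congr 2
    have hr : r ∈ (Finset.univ.erase p).erase q := by simp [hp, hq]
    rw [← Finset.mul_prod_erase _ _ hr, ← Finset.mul_prod_erase _ _ hr]
    simp only [Equiv.Perm.mul_apply, Equiv.swap_apply_left, Equiv.swap_apply_right,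
      Equiv.swap_apply_of_ne_of_ne hpq hp.symm]
    have : ∏ k ∈ ((Finset.univ.erase p).erase q).erase r, M (σ (Equiv.swap q r k)) k =
        ∏ k ∈ ((Finset.univ.erase p).erase q).erase r, M (σ k) k := by
      refine Finset.prod_congr rfl fun k hk => ?_
      simp only [Finset.mem_erase, Finset.mem_univ, and_true] at hk
      rw [Equiv.swap_apply_of_ne_of_ne hk.2.1 hk.1]
    rw [this]
    ring
  have h2 : (2 : ℂ) • detPair M p q (fun i j => v i * M j r) = 0 := by
    rw [two_smul]
    linear_combination key
  exact (smul_eq_zero.1 h2).resolve_left two_ne_zero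

theorem detPair_eq_zero_left (M : Matrix ι ι A) {p q r : ι} (hpq : p ≠ q) (hp : r ≠ p)
    (hq : r ≠ q) (w : ι → A) : detPair M p q (fun i j => M i r * w j) = 0 := by
  have := detPair_swap M hpq (fun i j => w i * M j r)
  rw [detPair_eq_zero_right M hpq hp hq w, neg_zero] at this
  rw [← this]
  congr 1
  funext i j
  ring

theorem IsSecondOrder.map_det {L : A →ₗ[ℂ] A} {Γ : A →ₗ[ℂ] Derivation ℂ A A}
    (h : IsSecondOrder L Γ) (M : Matrix ι ι A) :
    L M.det = ∑ σ : Equiv.Perm ι, Equiv.Perm.sign σ •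
        ∑ q, L (M (σ q) q) * ∏ k ∈ Finset.univ.erase q, M (σ k) k +
      (2⁻¹ : ℂ) • ∑ p, ∑ q ∈ Finset.univ.erase p,
        detPair M p q (fun i j => Γ (M i p) (M j q)) := by
  rw [Matrix.det_apply, map_sum]
  have h1 : ∀ σ : Equiv.Perm ι, L (Equiv.Perm.sign σ • ∏ i, M (σ i) i) =
      Equiv.Perm.sign σ • L (∏ i, M (σ i) i) := by
    intro σ
    rw [Units.smul_def, Units.smul_def, map_zsmul]
  simp only [h1, h.map_prod, smul_add, Finset.sum_add_distrib]
  congr 1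
  simp only [detPair]
  have h2 : ∀ p, ∑ q ∈ Finset.univ.erase p, ∑ σ : Equiv.Perm ι, Equiv.Perm.sign σ •
      (Γ (M (σ p) p) (M (σ q) q) * ∏ k ∈ (Finset.univ.erase p).erase q, M (σ k) k) =
      ∑ σ : Equiv.Perm ι, ∑ q ∈ Finset.univ.erase p, Equiv.Perm.sign σ •
      (Γ (M (σ p) p) (M (σ q) q) * ∏ k ∈ (Finset.univ.erase p).erase q, M (σ k) k) :=
    fun p => Finset.sum_comm
  simp only [h2]
  rw [Finset.sum_comm, Finset.smul_sum]
  refine Finset.sum_congr rfl fun σ _ => ?_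
  simp only [Finset.smul_sum]
  refine Finset.sum_congr rfl fun p _ => Finset.sum_congr rfl fun q _ => ?_
  rw [smul_comm]

/-- There are `q` indices below `q`, so `q` is the larger entry of `2q` ordered pairs. -/
theorem Fin.sum_sum_erase_max {N : ℕ} (F : Fin N → ℂ) :
    ∑ p, ∑ q ∈ Finset.univ.erase p, F (max p q) = 2 * ∑ q : Fin N, (q : ℂ) * F q := by
  have h1 : ∀ p : Fin N, ∑ q ∈ Finset.univ.erase p, F (max p q) =
      ∑ q, ((if q < p then F p else 0) + if p < q then F q else 0) := by
    intro p
    rw [← Finset.filter_ne' Finset.univ p, Finset.sum_filter]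
    refine Finset.sum_congr rfl fun q _ => ?_
    rcases lt_trichotomy p q with hpq | rfl | hpq
    · simp [hpq, hpq.ne', hpq.le, not_lt.2 hpq.le]
    · simp
    · simp [hpq, hpq.ne, hpq.le, not_lt.2 hpq.le]
  have h2 : ∑ p : Fin N, ∑ q, (if p < q then F q else 0) =
      ∑ p : Fin N, ∑ q, (if q < p then F p else 0) := Finset.sum_comm
  simp only [h1, Finset.sum_add_distrib]
  rw [h2, ← two_mul]
  congr 1
  refine Finset.sum_congr rfl fun p _ => ?_
  rw [← Finset.sum_filter, Finset.sum_const, nsmul_eq_mul]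
  congr 2
  rw [← Fin.card_Iio p]
  congr 1
  ext q
  simp

/-! Determinants in the complete homogeneous polynomials -/

variable {L : A →ₗ[ℂ] A} {Γ : A →ₗ[ℂ] Derivation ℂ A A} {c : ℂ} {x : ℕ+ → A}

/-- The matrix `(h_{n_i + j})`. -/
noncomputable def hMatrix (x : ℕ+ → A) {N : ℕ} (n : Fin N → ℤ) : Matrix (Fin N) (Fin N) A :=
  Matrix.of fun i j => hInt x (n i + (j : ℕ))

/-- Let `G s t` carry the symbol of `h_{n_i+s}` and `h_{n_j+t}` in the slots `p, q`, and let `V s t`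
carry the product of `h_{n_i+s}` with `(n_j+t) h_{n_j+t}`. Moving along the antidiagonal from `(p,
q)` to `(q, p)` turns `G` into `-G`, and each move costs `V` terms by `join_recurrence`. Those whose
first argument lies strictly between `p` and `q` repeat a column of the matrix and vanish. What is
left is `2 G = -2c V` at `(p, q)`. -/
theorem IsCutJoinSeq.detPair_of_lt (hL : IsSecondOrder L Γ) (h : IsCutJoinSeq L Γ c x) {N : ℕ}
    (n : Fin N → ℤ) {p q : Fin N} (hpq : p < q) :
    detPair (hMatrix x n) p q (fun i j => Γ (hMatrix x n i p) (hMatrix x n j q)) =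
      -(c • detPair (hMatrix x n) p q
        (fun i j => hMatrix x n i p * ((n j + (q : ℕ) : ℂ) • hMatrix x n j q))) := by
  set M := hMatrix x n with hM
  set G : ℤ → ℤ → A := fun s t => detPair M p q (fun i j => Γ (hInt x (n i + s)) (hInt x (n j + t)))
    with hG
  set V : ℤ → ℤ → A := fun s t =>
    detPair M p q (fun i j => hInt x (n i + s) * ((n j + t : ℂ) • hInt x (n j + t))) with hV
  have hGswap : ∀ s t, G t s = -G s t := by
    intro s t
    simp only [hG]
    rw [← detPair_swap M hpq.ne]
    congr 1
    funext i j
    rw [hL.symm]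
  -- The first product on the right of `join_recurrence` has its weight on the first slot;
  -- `detPair_swap` moves it to the second at the cost of a sign, so both terms take the form `V`.
  have hrec : ∀ s t, G s (t + 1) - G (s + 1) t = -(c • (V t (s + 1) + V s (t + 1))) := by
    intro s t
    simp only [hG, hV]
    rw [← neg_neg (detPair M p q fun i j => hInt x (n i + t) * _), ← detPair_swap M hpq.ne,
      detPair_sub, neg_add_eq_sub, ← smul_neg, neg_sub, detPair_sub, smul_detPair]
    congr 1
    funext i j
    have := h.join_recurrence hL (n i + s) (n j + t)
    rw [add_assoc, add_assoc] at this
    rw [this, mul_comm (hInt x (n j + t))]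
    push_cast
    simp only [add_assoc]
  have hVz : ∀ r : Fin N, r ≠ p → r ≠ q → ∀ t, V (r : ℕ) t = 0 := by
    intro r hp hq t
    exact detPair_eq_zero_left M hpq.ne hp hq (fun j => (n j + t : ℂ) • hInt x (n j + t))
  obtain ⟨d, hd⟩ : ∃ d : ℕ, (q : ℕ) = p + d := ⟨q - p, by omega⟩
  have hd0 : 0 < d := by omega
  have htel : G (p : ℕ) (q : ℕ) - G (q : ℕ) (p : ℕ) =
      ∑ t ∈ Finset.range d, (G ((p : ℕ) + t) ((q : ℕ) - t) -
        G ((p : ℕ) + (t + 1 : ℕ)) ((q : ℕ) - (t + 1 : ℕ))) := by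
    rw [Finset.sum_range_sub' (fun t : ℕ => G ((p : ℕ) + t) ((q : ℕ) - t))]
    have e1 : ((p : ℕ) : ℤ) + (d : ℕ) = (q : ℕ) := by omega
    have e2 : ((q : ℕ) : ℤ) - (d : ℕ) = (p : ℕ) := by omega
    rw [e1, e2]
    simp
  have hsum1 : ∑ t ∈ Finset.range d, V ((p : ℕ) + t) ((q : ℕ) - t) = V (p : ℕ) (q : ℕ) := by
    rw [Finset.sum_eq_single_of_mem 0 (by simpa using hd0)]
    · simp
    · intro t ht ht0
      rw [Finset.mem_range] at ht
      have := hVz ⟨p + t, by omega⟩ (by simp [Fin.ext_iff, ht0]) (by simp [Fin.ext_iff]; omega)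
        ((q : ℕ) - t)
      simpa using this
  -- Here the first argument descends from `q - 1` to `p`, so the surviving term is the last one; it
  -- is the previous sum reversed.
  have hsum2 : ∑ t ∈ Finset.range d, V ((q : ℕ) - (t + 1 : ℕ)) ((p : ℕ) + (t + 1 : ℕ)) =
      V (p : ℕ) (q : ℕ) := by
    rw [← hsum1, ← Finset.sum_range_reflect]
    refine Finset.sum_congr rfl fun t ht => ?_
    rw [Finset.mem_range] at ht
    congr 1 <;> omega
  have hterm : ∀ t ∈ Finset.range d, G ((p : ℕ) + t) ((q : ℕ) - t) -
      G ((p : ℕ) + (t + 1 : ℕ)) ((q : ℕ) - (t + 1 : ℕ)) =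
      -(c • (V ((q : ℕ) - (t + 1 : ℕ)) ((p : ℕ) + (t + 1 : ℕ)) + V ((p : ℕ) + t) ((q : ℕ) - t))) := by
    intro t _
    have := hrec ((p : ℕ) + t) ((q : ℕ) - (t + 1 : ℕ))
    push_cast at this ⊢
    rw [show ((q : ℕ) : ℤ) - (t + 1) + 1 = (q : ℕ) - t by ring, add_assoc] at this
    exact this
  rw [Finset.sum_congr rfl hterm, Finset.sum_neg_distrib, ← Finset.smul_sum,
    Finset.sum_add_distrib, hsum1, hsum2, hGswap (p : ℕ) (q : ℕ)] at htel
  have h2 : (2 : ℂ) • (G (p : ℕ) (q : ℕ) - -(c • V (p : ℕ) (q : ℕ))) = 0 := by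
    rw [two_smul]
    rw [smul_add] at htel
    linear_combination htel
  have h3 := sub_eq_zero.1 ((smul_eq_zero.1 h2).resolve_left two_ne_zero)
  simp only [hG, hV, Int.cast_natCast] at h3
  exact h3

/-- In the Leibniz expansion the term of `σ` is multiplied by a scalar. Column `q`, with `n = n (σ
q)`, gives `c (n+q)(n+q-1)/2` on its own and `-c q (n+q)` from its pairs with smaller columns. The
mixed terms `n q` cancel, leaving `c (n(n-1)/2 - q(q+1)/2)`, whose sum over `q` does not depend on
`σ`. -/
theorem IsCutJoinSeq.map_det (hL : IsSecondOrder L Γ) (h : IsCutJoinSeq L Γ c x) {N : ℕ}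
    (n : Fin N → ℤ) :
    L (hMatrix x n).det = (c * ∑ i : Fin N, ((n i : ℂ) * (n i - 1) / 2 - (i : ℂ) * (i + 1) / 2)) •
      (hMatrix x n).det := by
  set M := hMatrix x n with hM
  have hpair : ∀ p q : Fin N, p < q → detPair M p q (fun i j => Γ (M i p) (M j q)) =
      ∑ σ : Equiv.Perm (Fin N), Equiv.Perm.sign σ •
        ((-c * (n (σ q) + (q : ℕ))) • ∏ k, M (σ k) k) := by
    intro p q hpq
    rw [h.detPair_of_lt hL n hpq, ← smul_neg, smul_neg, ← neg_smul, smul_detPair, detPair]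
    refine Finset.sum_congr rfl fun σ _ => ?_
    congr 1
    rw [← Finset.mul_prod_erase _ _ (Finset.mem_univ p), ← Finset.mul_prod_erase _ _
      (Finset.mem_erase.2 ⟨hpq.ne', Finset.mem_univ q⟩), mul_smul_comm, smul_smul, smul_mul_assoc,
      mul_assoc]
  -- The weight always sits on the larger column, in whichever order the pair is listed, because `Γ`
  -- is symmetric.
  have hpair' : ∀ p, ∀ q ∈ Finset.univ.erase p, detPair M p q (fun i j => Γ (M i p) (M j q)) =
      ∑ σ : Equiv.Perm (Fin N), Equiv.Perm.sign σ •
        ((-c * (n (σ (max p q)) + (max p q : Fin N))) • ∏ k, M (σ k) k) := by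
    intro p q hq
    rcases lt_or_gt_of_ne (Finset.ne_of_mem_erase hq) with hlt | hlt
    · rw [max_eq_left hlt.le, ← hpair q p hlt, detPair_comm]
      congr 1
      funext i j
      rw [hL.symm]
    · rw [max_eq_right hlt.le, hpair p q hlt]
  rw [hL.map_det, Finset.sum_congr rfl fun p _ => Finset.sum_congr rfl (hpair' p)]
  have hcomm : ∑ p : Fin N, ∑ q ∈ Finset.univ.erase p, ∑ σ : Equiv.Perm (Fin N),
      Equiv.Perm.sign σ • ((-c * (n (σ (max p q)) + (max p q : Fin N))) • ∏ k, M (σ k) k) =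
      ∑ σ : Equiv.Perm (Fin N), Equiv.Perm.sign σ •
        ((∑ p : Fin N, ∑ q ∈ Finset.univ.erase p,
          (-c * (n (σ (max p q)) + (max p q : Fin N)))) • ∏ k, M (σ k) k) := by
    simp only [Finset.sum_smul, Finset.smul_sum]
    exact (Finset.sum_congr rfl fun p _ => Finset.sum_comm).trans Finset.sum_comm
  rw [hcomm, Matrix.det_apply, Finset.smul_sum, Finset.smul_sum, ← Finset.sum_add_distrib]
  refine Finset.sum_congr rfl fun σ _ => ?_
  rw [smul_comm (2⁻¹ : ℂ), ← smul_add, smul_comm (_ : ℂ) (Equiv.Perm.sign σ)]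
  congr 1
  have hdiag : ∀ q ∈ Finset.univ, L (M (σ q) q) * ∏ k ∈ Finset.univ.erase q, M (σ k) k =
      (c * ((n (σ q) + (q : ℕ)) * (n (σ q) + (q : ℕ) - 1) / 2) : ℂ) • ∏ k, M (σ k) k := by
    intro q _
    have := h.map_hInt hL (n (σ q) + (q : ℕ))
    rw [← Finset.mul_prod_erase _ _ (Finset.mem_univ q), ← smul_mul_assoc]
    congr 1
    push_cast at this
    exact this
  rw [Finset.sum_congr rfl hdiag, ← Finset.sum_smul, smul_smul, ← add_smul]
  congr 1
  rw [Fin.sum_sum_erase_max (fun q => -c * (n (σ q) + (q : Fin N)))]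
  rw [← mul_assoc, inv_mul_cancel₀ two_ne_zero, one_mul, Finset.sum_sub_distrib,
    ← Equiv.sum_comp σ (fun i => (n i : ℂ) * (n i - 1) / 2), ← Finset.sum_sub_distrib,
    Finset.mul_sum, ← Finset.sum_add_distrib]
  refine Finset.sum_congr rfl fun q _ => ?_
  ring

/-- Every term of the Leibniz expansion has the same degree `∑ (n i + i)`. -/
theorem derivation_det (D : Derivation ℂ A A) (hD : ∀ n : ℕ+, D (x n) = (c * n) • x n) {N : ℕ}
    (n : Fin N → ℤ) :
    D (hMatrix x n).det = (c * ∑ i : Fin N, ((n i : ℂ) + i)) • (hMatrix x n).det := by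
  have h1 : ∀ σ : Equiv.Perm (Fin N), D (Equiv.Perm.sign σ • ∏ i, hMatrix x n (σ i) i) =
      Equiv.Perm.sign σ • D (∏ i, hMatrix x n (σ i) i) := by
    intro σ
    rw [Units.smul_def, Units.smul_def, map_zsmul]
  rw [Matrix.det_apply, map_sum, Finset.smul_sum]
  refine Finset.sum_congr rfl fun σ _ => ?_
  rw [h1, smul_comm (_ : ℂ)]
  congr 1
  have hdiag : ∀ q ∈ Finset.univ, D (hMatrix x n (σ q) q) *
      ∏ k ∈ Finset.univ.erase q, hMatrix x n (σ k) k =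
      (c * (n (σ q) + (q : ℕ)) : ℂ) • ∏ k, hMatrix x n (σ k) k := by
    intro q _
    have := derivation_hInt_of_eigen x D c hD (n (σ q) + (q : ℕ))
    rw [← Finset.mul_prod_erase _ _ (Finset.mem_univ q), ← smul_mul_assoc]
    congr 1
    push_cast at this
    exact this
  rw [Derivation.map_prod', Finset.sum_congr rfl hdiag, ← Finset.sum_smul, Finset.sum_add_distrib,
    ← Equiv.sum_comp σ (fun i => (n i : ℂ)), ← Finset.sum_add_distrib, Finset.mul_sum]

/-! Schur polynomials -/

theorem schurPoly_eq_det (μ : YoungDiagram) (x : ℕ+ → A) :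
    schurPoly μ x =
      (hMatrix x fun i : Fin (μ.colLen 0) => (μ.rowLen i : ℤ) - (i : ℕ)).det := by
  rw [schurPoly]
  congr 1
  ext i j
  simp only [hMatrix, Matrix.of_apply]
  split_ifs with hij
  · rw [← hInt_natCast]
    congr 1
    omega
  · rw [hInt_of_neg x (by omega)]

theorem IsCutJoinSeq.map_schurPoly (hL : IsSecondOrder L Γ) (h : IsCutJoinSeq L Γ c x)
    (μ : YoungDiagram) :
    L (schurPoly μ x) = (c / 2 * ∑ i ∈ Finset.range (μ.colLen 0),
      (μ.rowLen i : ℂ) * (μ.rowLen i - 2 * (i + 1) + 1)) • schurPoly μ x := by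
  rw [schurPoly_eq_det, h.map_det hL, Finset.sum_range, Finset.mul_sum, Finset.mul_sum]
  congr 1
  -- With rows counted from `0` and `n_i = λ_i - i`, the bracket equals `λ_i (λ_i - 2i - 1) / 2`.
  refine Finset.sum_congr rfl fun i _ => ?_
  push_cast
  ring

theorem derivation_schurPoly (D : Derivation ℂ A A) (hD : ∀ n : ℕ+, D (x n) = (c * n) • x n)
    (μ : YoungDiagram) :
    D (schurPoly μ x) = (c * ∑ i ∈ Finset.range (μ.colLen 0), (μ.rowLen i : ℂ)) •
      schurPoly μ x := by
  rw [schurPoly_eq_det, derivation_det D hD, Finset.sum_range]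
  congr 2
  refine Finset.sum_congr rfl fun i _ => ?_
  push_cast
  ring

theorem derivation_schurPoly_eq_zero (D : Derivation ℂ A A) (hD : ∀ n : ℕ+, D (x n) = 0)
    (μ : YoungDiagram) : D (schurPoly μ x) = 0 := by
  rw [derivation_schurPoly (c := 0) D (by simp [hD]), zero_mul, zero_smul]

theorem symbol_schurPoly_eq_zero (hL : IsSecondOrder L Γ) (x y : ℕ+ → A)
    (h : ∀ i j, Γ (x i) (y j) = 0) (μ ν : YoungDiagram) :
    Γ (schurPoly μ x) (schurPoly ν y) = 0 :=
  derivation_schurPoly_eq_zero _ (fun j => by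
    rw [hL.symm]
    exact derivation_schurPoly_eq_zero _ (fun i => by rw [hL.symm, h]) μ) ν

end Determinant

/-! Cycles of a permutation and their behavior under multiplication by a transposition -/

section Cycles

open Equiv

variable {n : ℕ}

/-- The support of the cycle of `u` through `x`, also for a fixed point `x`. -/
noncomputable def cycleClass (u : Perm (Fin n)) (x : Fin n) : Finset (Fin n) := by
  classical exact Finset.univ.filter fun y => u.SameCycle x y

@[simp] theorem mem_cycleClass {u : Perm (Fin n)} {x y : Fin n} :
    y ∈ cycleClass u x ↔ u.SameCycle x y := by
  simp [cycleClass]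

theorem self_mem_cycleClass (u : Perm (Fin n)) (x : Fin n) : x ∈ cycleClass u x :=
  mem_cycleClass.2 (Perm.SameCycle.refl u x)

theorem cycleClass_eq_iff {u : Perm (Fin n)} {x y : Fin n} :
    cycleClass u x = cycleClass u y ↔ u.SameCycle x y := by
  constructor
  · intro h
    have := self_mem_cycleClass u y
    rwa [← h, mem_cycleClass] at this
  · intro h
    ext z
    rw [mem_cycleClass, mem_cycleClass]
    exact ⟨fun hz => h.symm.trans hz, fun hz => h.trans hz⟩

theorem mem_cycleSupports {u : Perm (Fin n)} {O : Finset (Fin n)} :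
    O ∈ cycleSupports u ↔ ∃ x, cycleClass u x = O := by
  simp [cycleSupports, cycleClass]

theorem cycleClass_mem_cycleSupports (u : Perm (Fin n)) (x : Fin n) :
    cycleClass u x ∈ cycleSupports u :=
  mem_cycleSupports.2 ⟨x, rfl⟩

theorem cycleClass_eq_of_mem {u : Perm (Fin n)} {O : Finset (Fin n)} (hO : O ∈ cycleSupports u)
    {x : Fin n} (hx : x ∈ O) : cycleClass u x = O := by
  obtain ⟨y, rfl⟩ := mem_cycleSupports.1 hO
  exact (cycleClass_eq_iff.2 (mem_cycleClass.1 hx)).symm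

theorem card_pos_of_mem_cycleSupports {u : Perm (Fin n)} {O : Finset (Fin n)}
    (hO : O ∈ cycleSupports u) : 0 < O.card := by
  obtain ⟨y, rfl⟩ := mem_cycleSupports.1 hO
  exact Finset.card_pos.2 ⟨y, self_mem_cycleClass u y⟩

theorem apply_mem_iff_of_mem_cycleSupports {u : Perm (Fin n)} {O : Finset (Fin n)}
    (hO : O ∈ cycleSupports u) (x : Fin n) : u x ∈ O ↔ x ∈ O := by
  obtain ⟨y, rfl⟩ := mem_cycleSupports.1 hO
  simp

theorem sum_eq_sum_cycleSupports {M : Type*} [AddCommMonoid M] (u : Perm (Fin n))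
    (f : Fin n → M) : ∑ x, f x = ∑ O ∈ cycleSupports u, ∑ x ∈ O, f x := by
  rw [← Finset.sum_fiberwise_of_maps_to (g := cycleClass u)
    fun x _ => cycleClass_mem_cycleSupports u x]
  refine Finset.sum_congr rfl fun O hO => Finset.sum_congr ?_ fun _ _ => rfl
  ext x
  simp only [Finset.mem_filter, Finset.mem_univ, true_and]
  exact ⟨fun h => h ▸ self_mem_cycleClass u x, fun h => cycleClass_eq_of_mem hO h⟩

theorem isCycleOn_cycleClass (u : Perm (Fin n)) (x : Fin n) :
    u.IsCycleOn (cycleClass u x : Set (Fin n)) := by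
  refine ⟨⟨fun y hy => ?_, u.injective.injOn, fun y hy => ⟨u⁻¹ y, ?_, by simp⟩⟩, fun y hy z hz => ?_⟩
  · simpa using hy
  · simpa using hy
  · simp only [Finset.mem_coe, mem_cycleClass] at hy hz
    exact hy.symm.trans hz

theorem Equiv.Perm.SameCycle.rel_of_step {u : Perm (Fin n)} (R : Setoid (Fin n))
    (h : ∀ x, R x (u x)) {x y : Fin n} (hxy : u.SameCycle x y) : R x y := by
  obtain ⟨k, -, rfl⟩ := hxy.exists_pow_eq'
  clear hxy
  induction k with
  | zero => exact R.refl x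
  | succ k ih =>
    rw [pow_succ']
    exact R.trans ih (h _)

/-- The relation of lying on the same cycle. -/
def cycleSetoid (u : Perm (Fin n)) : Setoid (Fin n) where
  r := u.SameCycle
  iseqv := ⟨Perm.SameCycle.refl u, Perm.SameCycle.symm, Perm.SameCycle.trans⟩

/-- The join of the cycles through `i` and `j`. -/
def joinSetoid (u : Perm (Fin n)) (i j : Fin n) : Setoid (Fin n) where
  r x y := u.SameCycle x y ∨ (u.SameCycle i x ∨ u.SameCycle j x) ∧ (u.SameCycle i y ∨ u.SameCycle j y)
  iseqv := by
    refine ⟨fun x => Or.inl (Perm.SameCycle.refl u x), fun {x y} h => ?_, fun {x y z} h1 h2 => ?_⟩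
    · rcases h with h | h
      · exact Or.inl h.symm
      · exact Or.inr h.symm
    · rcases h1 with h1 | h1 <;> rcases h2 with h2 | h2
      · exact Or.inl (h1.trans h2)
      · exact Or.inr ⟨h2.1.imp (fun h => h.trans h1.symm) (fun h => h.trans h1.symm), h2.2⟩
      · exact Or.inr ⟨h1.1, h1.2.imp (fun h => h.trans h2) (fun h => h.trans h2)⟩
      · exact Or.inr ⟨h1.1, h2.2⟩

theorem apply_pow_apply (u : Perm (Fin n)) (t : ℕ) (x : Fin n) :
    u ((u ^ t) x) = (u ^ (t + 1)) x := by
  rw [pow_succ', Perm.mul_apply]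

theorem swap_mul_pow_apply {u : Perm (Fin n)} {i j : Fin n} {t : ℕ}
    (h : ∀ s, 1 ≤ s → s ≤ t → (u ^ s) i ≠ i ∧ (u ^ s) i ≠ j) :
    ((swap i j * u) ^ t) i = (u ^ t) i := by
  induction t with
  | zero => rfl
  | succ t ih =>
    have h1 := h (t + 1) (by omega) le_rfl
    rw [pow_succ', Perm.mul_apply, ih fun s hs hst => h s hs (by omega), Perm.mul_apply,
      apply_pow_apply, swap_apply_of_ne_of_ne h1.1 h1.2]

theorem pow_apply_ne_of_lt_card {u : Perm (Fin n)} {i : Fin n} {s t : ℕ} (hst : s ≠ t)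
    (hs : s < (cycleClass u i).card) (ht : t < (cycleClass u i).card) :
    (u ^ s) i ≠ (u ^ t) i := by
  intro h
  rw [(isCycleOn_cycleClass u i).pow_apply_eq_pow_apply (self_mem_cycleClass u i)] at h
  exact hst (h.eq_of_lt_of_lt hs ht)

/-- Starting at `i`, the new permutation follows `u` to the last element of the cycle of `i`; there
the return to `i` is redirected to `j`. -/
theorem sameCycle_swap_mul_of_not_sameCycle {u : Perm (Fin n)} {i j : Fin n}
    (h : ¬u.SameCycle i j) : (swap i j * u).SameCycle i j := by
  have hpos : 0 < (cycleClass u i).card := Finset.card_pos.2 ⟨i, self_mem_cycleClass u i⟩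
  have hcard := (isCycleOn_cycleClass u i).pow_card_apply (self_mem_cycleClass u i)
  obtain ⟨t, ht⟩ : ∃ t, (cycleClass u i).card = t + 1 := ⟨_, (Nat.succ_pred_eq_of_pos hpos).symm⟩
  have h1 : ((swap i j * u) ^ t) i = (u ^ t) i := by
    refine swap_mul_pow_apply fun s hs hst => ⟨?_, fun hj => h ⟨s, by simpa using hj⟩⟩
    exact pow_apply_ne_of_lt_card (t := 0) (by omega) (by omega) hpos
  refine ⟨(t + 1 : ℕ), ?_⟩
  rw [zpow_natCast, pow_succ', Perm.mul_apply, h1, Perm.mul_apply, apply_pow_apply,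
    ← ht, hcard, swap_apply_left]

/-- A single step of `swap i j * u` differs from a step of `u` only by exchanging the targets `i`
and `j`, which are equivalent for both relations. Single steps generate the cycle relation. -/
theorem sameCycle_swap_mul_iff {u : Perm (Fin n)} {i j : Fin n} (h : ¬u.SameCycle i j)
    {x y : Fin n} : (swap i j * u).SameCycle x y ↔ joinSetoid u i j x y := by
  have hij := sameCycle_swap_mul_of_not_sameCycle h
  have hle : ∀ {x y}, u.SameCycle x y → (swap i j * u).SameCycle x y := by
    intro x y hxy
    refine hxy.rel_of_step (cycleSetoid (swap i j * u)) fun x => ?_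
    change (swap i j * u).SameCycle x (u x)
    have hx : (swap i j * u).SameCycle x (swap i j (u x)) := by
      rw [← Perm.mul_apply, Perm.sameCycle_apply_right]
    rcases eq_or_ne (u x) i with h1 | h1
    · rw [h1, swap_apply_left] at hx
      rw [h1]
      exact hx.trans hij.symm
    rcases eq_or_ne (u x) j with h2 | h2
    · rw [h2, swap_apply_right] at hx
      rw [h2]
      exact hx.trans hij
    rwa [swap_apply_of_ne_of_ne h1 h2] at hx
  constructor
  · intro hxy
    refine hxy.rel_of_step (joinSetoid u i j) fun x => ?_
    have hx : u.SameCycle x (u x) := Perm.sameCycle_apply_right.2 (Perm.SameCycle.refl u x)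
    rw [Perm.mul_apply]
    rcases eq_or_ne (u x) i with h1 | h1
    · rw [h1, swap_apply_left]
      rw [h1] at hx
      exact Or.inr ⟨Or.inl hx.symm, Or.inr (Perm.SameCycle.refl u j)⟩
    rcases eq_or_ne (u x) j with h2 | h2
    · rw [h2, swap_apply_right]
      rw [h2] at hx
      exact Or.inr ⟨Or.inr hx.symm, Or.inl (Perm.SameCycle.refl u i)⟩
    rw [swap_apply_of_ne_of_ne h1 h2]
    exact Or.inl hx
  · rintro (hxy | ⟨hx, hy⟩)
    · exact hle hxy
    · have key : ∀ z, u.SameCycle i z ∨ u.SameCycle j z → (swap i j * u).SameCycle i z := by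
        rintro z (hz | hz)
        · exact hle hz
        · exact hij.trans (hle hz)
      exact (key x hx).symm.trans (key y hy)

theorem cycleClass_swap_mul_left {u : Perm (Fin n)} {i j : Fin n} (h : ¬u.SameCycle i j) :
    cycleClass (swap i j * u) i = cycleClass u i ∪ cycleClass u j := by
  ext y
  rw [mem_cycleClass, sameCycle_swap_mul_iff h, Finset.mem_union, mem_cycleClass, mem_cycleClass]
  constructor
  · rintro (h | h)
    · exact Or.inl h
    · exact h.2
  · exact fun h => Or.inr ⟨Or.inl (Perm.SameCycle.refl u i), h⟩

theorem cycleSupports_swap_mul_erase {u : Perm (Fin n)} {i j : Fin n} (h : ¬u.SameCycle i j) :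
    (cycleSupports (swap i j * u)).erase (cycleClass (swap i j * u) i) =
      ((cycleSupports u).erase (cycleClass u i)).erase (cycleClass u j) := by
  have key : ∀ x, ¬u.SameCycle i x → ¬u.SameCycle j x →
      cycleClass (swap i j * u) x = cycleClass u x := by
    intro x hi hj
    ext y
    rw [mem_cycleClass, sameCycle_swap_mul_iff h, mem_cycleClass]
    exact ⟨fun h => h.resolve_right fun h => h.1.elim hi hj, Or.inl⟩
  have hmem : ∀ x, (swap i j * u).SameCycle i x ↔ u.SameCycle i x ∨ u.SameCycle j x := by
    intro x
    rw [← mem_cycleClass, cycleClass_swap_mul_left h, Finset.mem_union, mem_cycleClass,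
      mem_cycleClass]
  ext O
  simp only [Finset.mem_erase, mem_cycleSupports]
  constructor
  · rintro ⟨hO, x, rfl⟩
    have hx : ¬(swap i j * u).SameCycle i x := fun hx => hO (cycleClass_eq_iff.2 hx.symm)
    rw [hmem, not_or] at hx
    rw [key x hx.1 hx.2]
    exact ⟨fun h => hx.2 (cycleClass_eq_iff.1 h).symm, fun h => hx.1 (cycleClass_eq_iff.1 h).symm,
      x, rfl⟩
  · rintro ⟨hj, hi, x, rfl⟩
    have h1 : ¬u.SameCycle i x := fun hx => hi (cycleClass_eq_iff.2 hx.symm)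
    have h2 : ¬u.SameCycle j x := fun hx => hj (cycleClass_eq_iff.2 hx.symm)
    rw [← key x h1 h2]
    refine ⟨fun hx => ?_, x, rfl⟩
    rcases (hmem x).1 (cycleClass_eq_iff.1 hx).symm with hx | hx
    · exact h1 hx
    · exact h2 hx

/-- Multiplication by `swap i j`, with `j = u ^ t i`, splits the cycle of `i`; the part containing
`i` has `t` elements. -/
theorem cycleClass_swap_mul_pow {u : Perm (Fin n)} {i : Fin n} {t : ℕ} (ht : 1 ≤ t)
    (htc : t < (cycleClass u i).card) :
    cycleClass (swap i ((u ^ t) i) * u) i = (Finset.range t).image fun s => (u ^ s) i := by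
  set j := (u ^ t) i with hj
  have hpow : ∀ s < t, ((swap i j * u) ^ s) i = (u ^ s) i := by
    intro s hs
    refine swap_mul_pow_apply fun r hr hrs => ⟨?_, ?_⟩
    · exact pow_apply_ne_of_lt_card (t := 0) (by omega) (by omega) (by omega)
    · exact pow_apply_ne_of_lt_card (by omega) (by omega) htc
  -- The `t`-th step of `u` would arrive at `j` for the first time, and the transposition sends it
  -- back to `i`.
  have hret : ((swap i j * u) ^ t) i = i := by
    obtain ⟨s, rfl⟩ : ∃ s, t = s + 1 := ⟨t - 1, by omega⟩
    rw [pow_succ', Perm.mul_apply, hpow s (by omega), Perm.mul_apply, apply_pow_apply,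
      ← hj, swap_apply_right]
  ext y
  rw [mem_cycleClass, Finset.mem_image]
  constructor
  · intro h
    obtain ⟨k, -, rfl⟩ := h.exists_pow_eq'
    refine ⟨k % t, Finset.mem_range.2 (Nat.mod_lt _ ht), ?_⟩
    rw [← hpow _ (Nat.mod_lt _ ht)]
    conv_rhs => rw [← Nat.mod_add_div k t, pow_add, Perm.mul_apply, pow_mul,
      Perm.pow_apply_eq_self_of_apply_eq_self hret]
  · rintro ⟨s, hs, rfl⟩
    rw [← hpow s (Finset.mem_range.1 hs)]
    exact ⟨s, by simp⟩

theorem card_cycleClass_swap_mul_pow {u : Perm (Fin n)} {i : Fin n} {t : ℕ} (ht : 1 ≤ t)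
    (htc : t < (cycleClass u i).card) :
    (cycleClass (swap i ((u ^ t) i) * u) i).card = t := by
  rw [cycleClass_swap_mul_pow ht htc, Finset.card_image_of_injOn, Finset.card_range]
  intro a ha b hb hab
  rw [Finset.mem_coe, Finset.mem_range] at ha hb
  by_contra hne
  exact pow_apply_ne_of_lt_card hne (by omega) (by omega) hab

theorem not_sameCycle_swap_mul_pow {u : Perm (Fin n)} {i : Fin n} {t : ℕ} (ht : 1 ≤ t)
    (htc : t < (cycleClass u i).card) :
    ¬(swap i ((u ^ t) i) * u).SameCycle i ((u ^ t) i) := by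
  rw [← mem_cycleClass, cycleClass_swap_mul_pow ht htc, Finset.mem_image]
  rintro ⟨s, hs, h⟩
  rw [Finset.mem_range] at hs
  exact pow_apply_ne_of_lt_card (by omega) (by omega) htc h

/-- Parametrizing the second point by its distance `t` from `i` turns the choice of `j` into the
choice of the length of one piece of the cut cycle. -/
theorem sum_cycleClass_erase {M : Type*} [AddCommMonoid M] (u : Perm (Fin n)) (i : Fin n)
    (f : Fin n → M) :
    ∑ j ∈ (cycleClass u i).erase i, f j =
      ∑ t ∈ Finset.Ico 1 (cycleClass u i).card, f ((u ^ t) i) := by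
  symm
  refine Finset.sum_bij (fun t _ => (u ^ t) i) ?_ ?_ ?_ fun _ _ => rfl
  · intro t ht
    rw [Finset.mem_Ico] at ht
    rw [Finset.mem_erase, mem_cycleClass]
    exact ⟨pow_apply_ne_of_lt_card (t := 0) (by omega) ht.2 (by omega), t, by simp⟩
  · intro s hs t ht h
    rw [Finset.mem_Ico] at hs ht
    by_contra hne
    exact pow_apply_ne_of_lt_card hne hs.2 ht.2 h
  · intro j hj
    rw [Finset.mem_erase] at hj
    obtain ⟨t, ht, rfl⟩ := (isCycleOn_cycleClass u i).exists_pow_eq (self_mem_cycleClass u i) hj.2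
    refine ⟨t, Finset.mem_Ico.2 ⟨?_, ht⟩, rfl⟩
    rcases Nat.eq_zero_or_pos t with rfl | h
    · simp at hj
    · exact h

end Cycles

/-! The action of the reflections on the monomials of the cycle types -/

section ThetaAction

open Equiv

variable {m n : ℕ}

/-- The variable `p_r^{(γ)}`, with `p_0^{(γ)} = 0`. -/
noncomputable def powerVar (γ : ZMod m) (r : ℕ) : PRing m :=
  extendZero (fun k : ℕ+ => MvPolynomial.X (γ, k)) r

/-- The cycle product of `w` along the set `O`. -/
def GMatrix.cycleColor (w : GMatrix m n) (O : Finset (Fin n)) : ZMod m := ∑ x ∈ O, w.color x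

theorem monomial_type (w : GMatrix m n) :
    MvPolynomial.monomial w.type (1 : ℂ) =
      ∏ O ∈ cycleSupports w.perm, powerVar (w.cycleColor O) O.card := by
  rw [GMatrix.type, MvPolynomial.monomial_sum_one]
  refine Finset.prod_congr rfl fun O hO => ?_
  have h := card_pos_of_mem_cycleSupports hO
  have h' : O.card.toPNat' = ⟨O.card, h⟩ := PNat.eq (by simp [Nat.toPNat'_coe, h])
  rw [powerVar, extendZero, dif_pos h, MvPolynomial.X, h']
  rfl

theorem sum_single_comp (u : Perm (Fin n)) (S : Finset (Fin n)) (i : Fin n) (α : ZMod m) :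
    ∑ k ∈ S, (Pi.single i α : Fin n → ZMod m) (u k) = if u⁻¹ i ∈ S then α else 0 := by
  have : ∀ k ∈ S, (Pi.single i α : Fin n → ZMod m) (u k) = if k = u⁻¹ i then α else 0 := by
    intro k _
    rw [Pi.single_apply]
    congr 1
    rw [Perm.eq_inv_iff_eq]
  rw [Finset.sum_congr rfl this, Finset.sum_ite_eq']

theorem cycleColor_swapReflection_mul (w : GMatrix m n) (i j : Fin n) (α : ZMod m)
    (S : Finset (Fin n)) :
    (GMatrix.swapReflection i j α * w).cycleColor S = (if w.perm⁻¹ i ∈ S then α else 0) +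
      (if w.perm⁻¹ j ∈ S then -α else 0) + w.cycleColor S := by
  simp only [GMatrix.cycleColor, GMatrix.mul_color, Finset.sum_add_distrib]
  congr 1
  simp only [GMatrix.swapReflection, Pi.add_apply, Finset.sum_add_distrib]
  rw [sum_single_comp, sum_single_comp]

theorem cycleColor_diagReflection_mul (w : GMatrix m n) (i : Fin n) (α : ZMod m)
    (S : Finset (Fin n)) :
    (GMatrix.diagReflection i α * w).cycleColor S =
      (if w.perm⁻¹ i ∈ S then α else 0) + w.cycleColor S := by
  simp only [GMatrix.cycleColor, GMatrix.mul_color, Finset.sum_add_distrib]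
  congr 1
  exact sum_single_comp _ _ _ _

theorem swapReflection_mul_perm (w : GMatrix m n) (i j : Fin n) (α : ZMod m) :
    (GMatrix.swapReflection i j α * w).perm = swap i j * w.perm := rfl

theorem diagReflection_mul_perm (w : GMatrix m n) (i : Fin n) (α : ZMod m) :
    (GMatrix.diagReflection i α * w).perm = w.perm := one_mul _

theorem inv_apply_mem_iff {u : Perm (Fin n)} {O : Finset (Fin n)} (hO : O ∈ cycleSupports u)
    (x : Fin n) : u⁻¹ x ∈ O ↔ x ∈ O := by
  rw [← apply_mem_iff_of_mem_cycleSupports hO]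
  simp

theorem monomial_type_diagReflection_mul (w : GMatrix m n) (i : Fin n) (k : ZMod m) :
    MvPolynomial.monomial (GMatrix.diagReflection i k * w).type (1 : ℂ) =
      powerVar (w.cycleColor (cycleClass w.perm i) + k) (cycleClass w.perm i).card *
        ∏ O ∈ (cycleSupports w.perm).erase (cycleClass w.perm i),
          powerVar (w.cycleColor O) O.card := by
  have hi := cycleClass_mem_cycleSupports w.perm i
  rw [monomial_type, diagReflection_mul_perm, ← Finset.mul_prod_erase _ _ hi]
  congr 1
  · rw [cycleColor_diagReflection_mul, if_pos, add_comm]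
    rw [inv_apply_mem_iff hi]
    exact self_mem_cycleClass _ _
  · refine Finset.prod_congr rfl fun O hO => ?_
    rw [Finset.mem_erase] at hO
    rw [cycleColor_diagReflection_mul, if_neg, zero_add]
    rw [inv_apply_mem_iff hO.2]
    exact fun h => hO.1 (cycleClass_eq_of_mem hO.2 h).symm

/-- Each of the `|O|` positions in a cycle `O` has the same effect, a shift of its color by `k`;
this multiplicity is the factor `r` in `hD`. -/
theorem sum_monomial_type_diagReflection_mul (w : GMatrix m n) (k : ZMod m)
    (D : Derivation ℂ (PRing m) (PRing m))
    (hD : ∀ (γ : ZMod m) (r : ℕ), D (powerVar γ r) = (r : ℂ) • powerVar (γ + k) r) :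
    ∑ i, MvPolynomial.monomial (GMatrix.diagReflection i k * w).type (1 : ℂ) =
      D (MvPolynomial.monomial w.type (1 : ℂ)) := by
  rw [monomial_type, Derivation.map_prod', sum_eq_sum_cycleSupports w.perm]
  refine Finset.sum_congr rfl fun O hO => ?_
  have : ∀ i ∈ O, MvPolynomial.monomial (GMatrix.diagReflection i k * w).type (1 : ℂ) =
      powerVar (w.cycleColor O + k) O.card *
        ∏ O ∈ (cycleSupports w.perm).erase O, powerVar (w.cycleColor O) O.card := by
    intro i hi
    rw [monomial_type_diagReflection_mul, cycleClass_eq_of_mem hO hi]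
  rw [Finset.sum_congr rfl this, Finset.sum_const, hD, smul_mul_assoc, Nat.cast_smul_eq_nsmul]

theorem cycleColor_union {w : GMatrix m n} {i j : Fin n} {u : Perm (Fin n)}
    (h : ¬u.SameCycle i j) : w.cycleColor (cycleClass u i ∪ cycleClass u j) =
      w.cycleColor (cycleClass u i) + w.cycleColor (cycleClass u j) ∧
      (cycleClass u i ∪ cycleClass u j).card = (cycleClass u i).card + (cycleClass u j).card := by
  have hd : Disjoint (cycleClass u i) (cycleClass u j) := by
    rw [Finset.disjoint_left]
    intro x hx hy
    rw [mem_cycleClass] at hx hy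
    exact h (hx.trans hy.symm)
  exact ⟨Finset.sum_union hd, Finset.card_union_of_disjoint hd⟩

/-- A reflection exchanging two axes joins two cycles. -/
theorem monomial_type_swapReflection_mul_join (w : GMatrix m n) {i j : Fin n}
    (h : ¬w.perm.SameCycle i j) (α : ZMod m) :
    MvPolynomial.monomial (GMatrix.swapReflection i j α * w).type (1 : ℂ) =
      powerVar (w.cycleColor (cycleClass w.perm i) + w.cycleColor (cycleClass w.perm j))
        ((cycleClass w.perm i).card + (cycleClass w.perm j).card) *
        ∏ O ∈ ((cycleSupports w.perm).erase (cycleClass w.perm i)).erase (cycleClass w.perm j),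
          powerVar (w.cycleColor O) O.card := by
  have hi := cycleClass_mem_cycleSupports w.perm i
  have hj := cycleClass_mem_cycleSupports w.perm j
  obtain ⟨h1, h2⟩ := cycleColor_union (w := w) h
  rw [monomial_type, swapReflection_mul_perm,
    ← Finset.mul_prod_erase _ _ (cycleClass_mem_cycleSupports _ i),
    cycleSupports_swap_mul_erase h, cycleClass_swap_mul_left h, h2]
  congr 1
  -- The colors `α` and `-α` both land in the joined cycle and cancel, so the result is the same for
  -- all `α`.
  · rw [cycleColor_swapReflection_mul, if_pos, if_pos, h1, add_neg_cancel, zero_add]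
    · rw [Finset.mem_union, inv_apply_mem_iff hj]
      exact Or.inr (self_mem_cycleClass _ _)
    · rw [Finset.mem_union, inv_apply_mem_iff hi]
      exact Or.inl (self_mem_cycleClass _ _)
  · refine Finset.prod_congr rfl fun O hO => ?_
    rw [Finset.mem_erase, Finset.mem_erase] at hO
    rw [cycleColor_swapReflection_mul, if_neg, if_neg, zero_add, zero_add]
    · rw [inv_apply_mem_iff hO.2.2]
      exact fun h => hO.1 (cycleClass_eq_of_mem hO.2.2 h).symm
    · rw [inv_apply_mem_iff hO.2.2]
      exact fun h => hO.2.1 (cycleClass_eq_of_mem hO.2.2 h).symm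

/-- The reflections exchanging two axes cut a cycle. -/
theorem sum_monomial_type_swapReflection_mul_of_sameCycle [NeZero m] (w : GMatrix m n)
    {i j : Fin n} {u v : Perm (Fin n)} (hu : u = w.perm) (hv : v = swap i j * u)
    (hs : u.SameCycle i j) (hns : ¬v.SameCycle i j) :
    ∑ α : ZMod m, MvPolynomial.monomial (GMatrix.swapReflection i j α * w).type (1 : ℂ) =
      (∑ β : ZMod m, powerVar β (cycleClass v i).card *
        powerVar (w.cycleColor (cycleClass u i) - β)
          ((cycleClass u i).card - (cycleClass v i).card)) *
        ∏ O ∈ (cycleSupports u).erase (cycleClass u i), powerVar (w.cycleColor O) O.card := by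
  -- A cut is a join read backwards: `u` arises from `v` by joining the cycles of `i` and `j`, so
  -- the join lemmas apply to `v`.
  have hvu : swap i j * v = u := by rw [hv, ← mul_assoc, swap_mul_self, one_mul]
  have hunion : cycleClass u i = cycleClass v i ∪ cycleClass v j := by
    rw [← hvu, cycleClass_swap_mul_left hns]
  obtain ⟨h1, h2⟩ := cycleColor_union (w := w) hns
  rw [← hunion] at h1 h2
  have herase : (cycleSupports u).erase (cycleClass u i) =
      ((cycleSupports v).erase (cycleClass v i)).erase (cycleClass v j) := by
    rw [← cycleSupports_swap_mul_erase hns, hvu]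
  have hjmem : cycleClass v j ∈ (cycleSupports v).erase (cycleClass v i) :=
    Finset.mem_erase.2 ⟨fun h => hns (cycleClass_eq_iff.1 h).symm, cycleClass_mem_cycleSupports v j⟩
  -- The color placed at `i` is picked up at `u⁻¹ i`, which `v` sends to `j`. Hence `α` goes to the
  -- piece containing `j` and `-α` to the piece containing `i`.
  have hui : v.SameCycle j (u⁻¹ i) := by
    have : v (u⁻¹ i) = j := by simp [hv]
    rw [← this, Perm.sameCycle_apply_left]
  have huj : v.SameCycle i (u⁻¹ j) := by
    have : v (u⁻¹ j) = i := by simp [hv]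
    conv_lhs => rw [← this]
    rw [Perm.sameCycle_apply_left]
  have hmon : ∀ α : ZMod m, MvPolynomial.monomial (GMatrix.swapReflection i j α * w).type (1 : ℂ) =
      powerVar (w.cycleColor (cycleClass v i) - α) (cycleClass v i).card *
        powerVar (w.cycleColor (cycleClass v j) + α)
          ((cycleClass u i).card - (cycleClass v i).card) *
        ∏ O ∈ (cycleSupports u).erase (cycleClass u i), powerVar (w.cycleColor O) O.card := by
    intro α
    rw [monomial_type, swapReflection_mul_perm, ← hu, ← hv,
      ← Finset.mul_prod_erase _ _ (cycleClass_mem_cycleSupports v i),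
      ← Finset.mul_prod_erase _ _ hjmem, herase, mul_assoc, h2,
      Nat.add_sub_cancel_left]
    refine congrArg₂ HMul.hMul ?_ (congrArg₂ HMul.hMul ?_ ?_)
    · rw [cycleColor_swapReflection_mul, ← hu, if_neg, if_pos (mem_cycleClass.2 huj)]
      · congr 1; ring
      · rw [mem_cycleClass]
        exact fun h => hns (h.trans hui.symm)
    · rw [cycleColor_swapReflection_mul, ← hu, if_pos (mem_cycleClass.2 hui), if_neg]
      · congr 1; ring
      · rw [mem_cycleClass]
        exact fun h => hns (huj.trans h.symm)
    · refine Finset.prod_congr rfl fun O hO => ?_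
      rw [← herase, Finset.mem_erase] at hO
      have hiO : i ∉ O := fun h => hO.1 (cycleClass_eq_of_mem hO.2 h).symm
      rw [cycleColor_swapReflection_mul, ← hu, if_neg, if_neg, zero_add, zero_add]
      · rw [inv_apply_mem_iff hO.2]
        intro h
        refine hO.1 ?_
        rw [← cycleClass_eq_of_mem hO.2 h, cycleClass_eq_iff]
        exact hs.symm
      · rwa [inv_apply_mem_iff hO.2]
  rw [Finset.sum_congr rfl fun α _ => hmon α, ← Finset.sum_mul]
  refine congrArg₂ HMul.hMul ?_ rfl
  -- As `α` varies, the color `β` of the piece of `i` runs over all of `ℤ/m`, the other piece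
  -- carrying the complementary color.
  rw [← Equiv.sum_comp (Equiv.subLeft (w.cycleColor (cycleClass v i)))]
  refine Finset.sum_congr rfl fun α _ => ?_
  rw [Equiv.subLeft_apply, sub_sub_cancel, h1]
  refine congrArg₂ HMul.hMul rfl (congrArg₂ powerVar ?_ rfl)
  ring

theorem sum_monomial_type_swapReflection_mul_cut [NeZero m] (w : GMatrix m n) {i : Fin n} {t : ℕ}
    (ht : 1 ≤ t) (htc : t < (cycleClass w.perm i).card) :
    ∑ α : ZMod m, MvPolynomial.monomial
        (GMatrix.swapReflection i ((w.perm ^ t) i) α * w).type (1 : ℂ) =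
      (∑ β : ZMod m, powerVar β t *
        powerVar (w.cycleColor (cycleClass w.perm i) - β) ((cycleClass w.perm i).card - t)) *
        ∏ O ∈ (cycleSupports w.perm).erase (cycleClass w.perm i),
          powerVar (w.cycleColor O) O.card := by
  rw [sum_monomial_type_swapReflection_mul_of_sameCycle w rfl rfl ⟨t, by simp⟩
    (not_sameCycle_swap_mul_pow ht htc), card_cycleClass_swap_mul_pow ht htc]

theorem sum_erase_eq_cycleClass_add {M : Type*} [AddCommGroup M] (u : Perm (Fin n)) (i : Fin n)
    (f : Fin n → M) :
    ∑ j ∈ Finset.univ.erase i, f j = ∑ j ∈ (cycleClass u i).erase i, f j +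
      ∑ O ∈ (cycleSupports u).erase (cycleClass u i), ∑ j ∈ O, f j := by
  have h := sum_eq_sum_cycleSupports u f
  rw [← Finset.add_sum_erase _ _ (Finset.mem_univ i),
    ← Finset.add_sum_erase _ _ (cycleClass_mem_cycleSupports u i),
    ← Finset.add_sum_erase _ _ (self_mem_cycleClass u i), add_assoc] at h
  exact add_left_cancel h

theorem sum_sum_Ioi_eq_half {M : Type*} [AddCommGroup M] [Module ℂ M] (g : Fin n → Fin n → M)
    (hg : ∀ i j, g i j = g j i) :
    ∑ i, ∑ j ∈ Finset.Ioi i, g i j = (2⁻¹ : ℂ) • ∑ i, ∑ j ∈ Finset.univ.erase i, g i j := by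
  have h1 : ∀ i, ∑ j ∈ Finset.univ.erase i, g i j =
      ∑ j ∈ Finset.Ioi i, g i j + ∑ j ∈ Finset.Iio i, g i j := by
    intro i
    rw [← Finset.sum_union]
    · refine Finset.sum_congr ?_ fun _ _ => rfl
      ext j
      simp only [Finset.mem_erase, Finset.mem_univ, and_true, Finset.mem_union, Finset.mem_Ioi,
        Finset.mem_Iio]
      exact ⟨fun h => h.lt_or_gt.symm, fun h => h.elim ne_of_gt ne_of_lt⟩
    · rw [Finset.disjoint_left]
      intro j hj hj'
      rw [Finset.mem_Ioi] at hj
      rw [Finset.mem_Iio] at hj'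
      exact lt_asymm hj hj'
  have h2 : ∑ i, ∑ j ∈ Finset.Iio i, g i j = ∑ i, ∑ j ∈ Finset.Ioi i, g i j := by
    rw [Finset.sum_comm' (s' := Finset.Ioi) (t' := Finset.univ) (by simp)]
    exact Finset.sum_congr rfl fun i _ => Finset.sum_congr rfl fun j _ => hg j i
  rw [Finset.sum_congr rfl fun i _ => h1 i, Finset.sum_add_distrib, h2, ← two_smul ℂ, smul_smul,
    inv_mul_cancel₀ two_ne_zero, one_smul]

theorem swapReflection_comm (i j : Fin n) (α : ZMod m) :
    GMatrix.swapReflection j i α = GMatrix.swapReflection i j (-α) := by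
  rw [GMatrix.swapReflection, GMatrix.swapReflection, swap_comm, neg_neg, add_comm]

/-- Fix the cycle `O` of `i`. Points `j` in `O` cut it, and points in another cycle `O'` join it to
`O'`. The choice of `i` contributes `|O|`, in the join case `j` and `α` contribute `|O'|` and `m`,
and unordered pairs contribute `1/2`; these are the coefficients of `hcut` and `hjoin`. -/
theorem sum_monomial_type_swapReflection_mul [NeZero m] (w : GMatrix m n)
    {L : PRing m →ₗ[ℂ] PRing m} {Γ : PRing m →ₗ[ℂ] Derivation ℂ (PRing m) (PRing m)}
    (hL : IsSecondOrder L Γ)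
    (hcut : ∀ (γ : ZMod m) (r : ℕ), L (powerVar γ r) = (r / 2 : ℂ) •
      ∑ β : ZMod m, ∑ ij ∈ Finset.HasAntidiagonal.antidiagonal r,
        powerVar β ij.1 * powerVar (γ - β) ij.2)
    (hjoin : ∀ (α β : ZMod m) (a b : ℕ),
      Γ (powerVar α a) (powerVar β b) = (m * a * b : ℂ) • powerVar (α + β) (a + b)) :
    ∑ i, ∑ j ∈ Finset.Ioi i, ∑ α : ZMod m,
      MvPolynomial.monomial (GMatrix.swapReflection i j α * w).type (1 : ℂ) =
      L (MvPolynomial.monomial w.type (1 : ℂ)) := by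
  rw [sum_sum_Ioi_eq_half]
  swap
  · intro i j
    rw [← Equiv.sum_comp (Equiv.neg (ZMod m))]
    exact Finset.sum_congr rfl fun α _ => by rw [Equiv.neg_apply, ← swapReflection_comm]
  rw [monomial_type, hL.map_prod, sum_eq_sum_cycleSupports w.perm, Finset.smul_sum,
    Finset.smul_sum, ← Finset.sum_add_distrib]
  refine Finset.sum_congr rfl fun O hO => ?_
  have hi : ∀ i ∈ O, ∑ j ∈ Finset.univ.erase i, ∑ α : ZMod m,
      MvPolynomial.monomial (GMatrix.swapReflection i j α * w).type (1 : ℂ) =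
      (∑ β : ZMod m, ∑ ij ∈ Finset.HasAntidiagonal.antidiagonal O.card,
        powerVar β ij.1 * powerVar (w.cycleColor O - β) ij.2) *
        ∏ O ∈ (cycleSupports w.perm).erase O, powerVar (w.cycleColor O) O.card +
      ∑ O' ∈ (cycleSupports w.perm).erase O, (m * O'.card : ℂ) •
        (powerVar (w.cycleColor O + w.cycleColor O') (O.card + O'.card) *
        ∏ O ∈ ((cycleSupports w.perm).erase O).erase O', powerVar (w.cycleColor O) O.card) := by
    intro i hi
    have hOi := cycleClass_eq_of_mem hO hi
    rw [sum_erase_eq_cycleClass_add w.perm, sum_cycleClass_erase]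
    congr 1
    · have : ∀ t ∈ Finset.Ico 1 (cycleClass w.perm i).card, ∑ α : ZMod m, MvPolynomial.monomial
          (GMatrix.swapReflection i ((w.perm ^ t) i) α * w).type (1 : ℂ) =
          (∑ β : ZMod m, powerVar β t * powerVar (w.cycleColor O - β) (O.card - t)) *
            ∏ O ∈ (cycleSupports w.perm).erase O, powerVar (w.cycleColor O) O.card := by
        intro t ht
        rw [Finset.mem_Ico] at ht
        rw [sum_monomial_type_swapReflection_mul_cut w ht.1 ht.2, hOi]
      rw [Finset.sum_congr rfl this, ← Finset.sum_mul, Finset.sum_comm, hOi]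
      congr 1
      refine Finset.sum_congr rfl fun β _ => ?_
      -- The two ends of the antidiagonal contribute nothing since `powerVar _ 0 = 0`; the lengths
      -- `1, ..., |O| - 1` of actual cuts remain.
      rw [Finset.Nat.sum_antidiagonal_eq_sum_range_succ_mk, Finset.sum_range_succ, Nat.sub_self,
        Finset.range_eq_Ico, Finset.sum_eq_sum_Ico_succ_bot (card_pos_of_mem_cycleSupports hO)]
      simp [powerVar]
    · rw [hOi]
      refine Finset.sum_congr rfl fun O' hO' => ?_
      rw [Finset.mem_erase] at hO'
      have : ∀ j ∈ O', ∑ α : ZMod m,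
          MvPolynomial.monomial (GMatrix.swapReflection i j α * w).type (1 : ℂ) = (m : ℂ) •
          (powerVar (w.cycleColor O + w.cycleColor O') (O.card + O'.card) *
          ∏ O ∈ ((cycleSupports w.perm).erase O).erase O', powerVar (w.cycleColor O) O.card) := by
        intro j hj
        have hOj := cycleClass_eq_of_mem hO'.2 hj
        have hns : ¬w.perm.SameCycle i j := by
          intro h
          rw [← cycleClass_eq_iff, hOi, hOj] at h
          exact hO'.1 h.symm
        rw [Finset.sum_congr rfl fun α _ => monomial_type_swapReflection_mul_join w hns α,
          Finset.sum_const, hOi, hOj, Finset.card_univ, ZMod.card, Nat.cast_smul_eq_nsmul]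
      rw [Finset.sum_congr rfl this, Finset.sum_const, ← Nat.cast_smul_eq_nsmul ℂ, smul_smul,
        mul_comm]
  rw [Finset.sum_congr rfl hi, Finset.sum_const, smul_add, smul_add, hcut]
  congr 1
  · rw [← Nat.cast_smul_eq_nsmul ℂ, smul_smul, smul_mul_assoc]
    congr 1
    ring
  · rw [Finset.smul_sum, Finset.smul_sum, Finset.smul_sum]
    refine Finset.sum_congr rfl fun O' _ => ?_
    rw [hjoin, ← Nat.cast_smul_eq_nsmul ℂ, smul_mul_assoc, smul_smul, smul_smul, smul_smul]
    congr 1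
    ring

end ThetaAction

/-! Every colored partition is the type of some element -/

section TypeSurjective

open Equiv

variable {ι : Type*} {n : ℕ} {r : ι → ℕ+}

/-- The permutation rotating every fiber of a partition of `Fin n` into cyclic groups. -/
def rotatePerm (e : Fin n ≃ Σ p : ι, ZMod (r p)) : Perm (Fin n) :=
  (e.trans (Equiv.sigmaCongrRight fun _ => Equiv.addRight 1)).trans e.symm

theorem rotatePerm_pow_apply (e : Fin n ≃ Σ p : ι, ZMod (r p)) (k : ℕ) (x : Fin n) :
    ((rotatePerm e) ^ k) x = e.symm ⟨(e x).1, (e x).2 + k⟩ := by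
  induction k with
  | zero => simp
  | succ k ih =>
    rw [pow_succ', Perm.mul_apply, ih, rotatePerm]
    simp [add_assoc]

theorem sameCycle_rotatePerm_iff (e : Fin n ≃ Σ p : ι, ZMod (r p)) {x y : Fin n} :
    (rotatePerm e).SameCycle x y ↔ (e x).1 = (e y).1 := by
  constructor
  · intro h
    obtain ⟨k, -, rfl⟩ := h.exists_pow_eq'
    rw [rotatePerm_pow_apply]
    simp
  · intro h
    obtain ⟨a, rfl⟩ := e.symm.surjective x
    obtain ⟨⟨q, b⟩, rfl⟩ := e.symm.surjective y
    obtain ⟨p, a⟩ := a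
    simp only [apply_symm_apply] at h
    subst h
    refine ⟨((b - a).val : ℕ), ?_⟩
    rw [zpow_natCast, rotatePerm_pow_apply, apply_symm_apply, ZMod.natCast_zmod_val,
      add_sub_cancel]

theorem sum_fiber_sigma [Fintype ι] [DecidableEq ι] {M : Type*} [AddCommMonoid M]
    (e : Fin n ≃ Σ p : ι, ZMod (r p)) (p : ι) (f : (Σ p : ι, ZMod (r p)) → M) :
    ∑ x with (e x).1 = p, f (e x) = ∑ z : ZMod (r p), f ⟨p, z⟩ := by
  rw [Finset.sum_filter, Equiv.sum_comp e (fun y => if y.1 = p then f y else 0),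
    Fintype.sum_sigma, Finset.sum_eq_single p]
  · simp
  · intro q _ hq
    simp [hq]
  · simp

theorem cycleSupports_rotatePerm [Fintype ι] [DecidableEq ι] (e : Fin n ≃ Σ p : ι, ZMod (r p)) :
    cycleSupports (rotatePerm e) =
      Finset.univ.image fun p => Finset.univ.filter fun x => (e x).1 = p := by
  ext O
  rw [mem_cycleSupports, Finset.mem_image]
  constructor
  · rintro ⟨x, rfl⟩
    refine ⟨(e x).1, Finset.mem_univ _, ?_⟩
    ext y
    rw [mem_cycleClass, sameCycle_rotatePerm_iff]
    simp [eq_comm]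
  · rintro ⟨p, -, rfl⟩
    refine ⟨e.symm ⟨p, 0⟩, ?_⟩
    ext y
    rw [mem_cycleClass, sameCycle_rotatePerm_iff]
    simp [eq_comm]

/-- The whole color of a cycle is placed at its point `0`, so the cycle product is `γ p`. -/
theorem type_rotatePerm [Fintype ι] {m : ℕ} (e : Fin n ≃ Σ p : ι, ZMod (r p)) (γ : ι → ZMod m) :
    GMatrix.type ⟨rotatePerm e, fun x => if (e x).2 = 0 then γ (e x).1 else 0⟩ =
      ∑ p, Finsupp.single (γ p, r p) 1 := by
  classical
  rw [GMatrix.type, cycleSupports_rotatePerm, Finset.sum_image]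
  · refine Finset.sum_congr rfl fun p _ => ?_
    have h1 := sum_fiber_sigma e p (fun y => if y.2 = 0 then γ y.1 else 0)
    have h2 := sum_fiber_sigma e p (fun _ => 1)
    rw [← Finset.card_eq_sum_ones] at h2
    simp only [Finset.sum_const, Finset.card_univ, ZMod.card, smul_eq_mul, mul_one] at h1 h2
    rw [Finset.sum_eq_single 0 (fun z _ hz => if_neg hz) (by simp), if_pos rfl] at h1
    rw [h1, h2, PNat.coe_toPNat']
  · intro p _ q _ hpq
    have : e.symm ⟨p, 0⟩ ∈ Finset.univ.filter fun x => (e x).1 = p := by simp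
    simp only at hpq
    rw [hpq] at this
    simpa using this

/-- One cyclic group for every part, parts being pairs of a variable and a copy number. Without a
representative the class average would be zero and the value of `cutJoin` on `p_d` would be lost. -/
theorem exists_type_eq {m : ℕ} (d : ColoredMult m) : ∃ w : GMatrix m d.size, w.type = d := by
  classical
  set ι := Σ x : d.support, Fin (d x) with hι
  set r : ι → ℕ+ := fun p => (p.1 : ZMod m × ℕ+).2 with hr
  have hcard : Fintype.card (Fin d.size) = Fintype.card (Σ p : ι, ZMod (r p)) := by
    rw [Fintype.card_fin, Fintype.card_sigma]
    simp only [ZMod.card]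
    rw [Fintype.sum_sigma, ColoredMult.size, Finsupp.sum, ← Finset.sum_coe_sort]
    refine Finset.sum_congr rfl fun x _ => ?_
    simp [hr]
  refine ⟨_, (type_rotatePerm (Fintype.equivOfCardEq hcard) fun p => (p.1 : ZMod m × ℕ+).1).trans ?_⟩
  rw [Fintype.sum_sigma]
  conv_rhs => rw [← Finsupp.sum_single d, Finsupp.sum, ← Finset.sum_coe_sort]
  refine Finset.sum_congr rfl fun x _ => ?_
  simp [hr]

end TypeSurjective

/-! ### Cut-and-join operators as differential operators -/

section CutJoinOperator

variable {m : ℕ} [NeZero m]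

/-- By `h` the image of a product depends only on the type of `w`, so averaging over a class returns
the common value; centrality of the reflection sums is not needed. -/
theorem cutJoin_eq_of_theta (k : ZMod m) (T : PRing m →ₗ[ℂ] PRing m)
    (h : ∀ (n : ℕ) (w : GMatrix m n),
      theta m n (reflectionSum m n k * MonoidAlgebra.of ℂ (GMatrix m n) w) =
        T (MvPolynomial.monomial w.type (1 : ℂ))) : cutJoin m k = T := by
  refine (MvPolynomial.basisMonomials (ZMod m × ℕ+) ℂ).ext fun d => ?_
  rw [cutJoin, Module.Basis.constr_basis, MvPolynomial.coe_basisMonomials]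
  have hne : (conjClass (ColoredMult.size d) d).Nonempty := by
    obtain ⟨w, hw⟩ := exists_type_eq d
    exact ⟨w, by simpa [conjClass] using hw⟩
  have h0 : ((conjClass (ColoredMult.size d) d).card : ℂ) ≠ 0 := by exact_mod_cast hne.card_pos.ne'
  have h1 : ∀ x ∈ conjClass (ColoredMult.size d) d, theta m (ColoredMult.size d) (reflectionSum m (ColoredMult.size d) k *
      MonoidAlgebra.of ℂ (GMatrix m (ColoredMult.size d)) x) = T (MvPolynomial.monomial d 1) := by
    intro x hx
    have : x.type = d := by simpa [conjClass] using hx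
    rw [h, this]
  rw [classAverage, mul_smul_comm, Finset.mul_sum, map_smul, map_sum, Finset.sum_congr rfl h1,
    Finset.sum_const, ← Nat.cast_smul_eq_nsmul ℂ, smul_smul, inv_mul_cancel₀ h0, one_smul]

theorem cutJoin_zero_eq {L : PRing m →ₗ[ℂ] PRing m}
    {Γ : PRing m →ₗ[ℂ] Derivation ℂ (PRing m) (PRing m)} (hL : IsSecondOrder L Γ)
    (hcut : ∀ (γ : ZMod m) (r : ℕ), L (powerVar γ r) = (r / 2 : ℂ) •
      ∑ β : ZMod m, ∑ ij ∈ Finset.HasAntidiagonal.antidiagonal r,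
        powerVar β ij.1 * powerVar (γ - β) ij.2)
    (hjoin : ∀ (α β : ZMod m) (a b : ℕ),
      Γ (powerVar α a) (powerVar β b) = (m * a * b : ℂ) • powerVar (α + β) (a + b)) :
    cutJoin m 0 = L := by
  refine cutJoin_eq_of_theta 0 L fun n w => ?_
  rw [← sum_monomial_type_swapReflection_mul w hL hcut hjoin, reflectionSum, if_pos rfl]
  simp only [Finset.sum_mul, map_sum, ← map_mul, theta_of]

theorem cutJoin_eq_derivation {k : ZMod m} (hk : k ≠ 0) {D : Derivation ℂ (PRing m) (PRing m)}
    (hD : ∀ (γ : ZMod m) (r : ℕ), D (powerVar γ r) = (r : ℂ) • powerVar (γ + k) r) :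
    cutJoin m k = D := by
  refine cutJoin_eq_of_theta k D fun n w => ?_
  rw [Derivation.coeFn_coe, ← sum_monomial_type_diagReflection_mul w k D hD, reflectionSum,
    if_neg hk]
  simp only [Finset.sum_mul, map_sum, ← map_mul, theta_of]

/-! Existence of the operators -/

/-- The second order part `½ ∑ C_{xy} ∂_x ∂_y` of a differential operator. -/
noncomputable def secondOrderPart {σ : Type*} (C : σ → σ → MvPolynomial σ ℂ) (f : MvPolynomial σ ℂ) :
    MvPolynomial σ ℂ :=
  (2⁻¹ : ℂ) • ∑ x ∈ f.vars, ∑ y ∈ f.vars,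
    C x y * MvPolynomial.pderiv x (MvPolynomial.pderiv y f)

theorem pderiv_pderiv_comm {σ : Type*} (x y : σ) (f : MvPolynomial σ ℂ) :
    MvPolynomial.pderiv x (MvPolynomial.pderiv y f) =
      MvPolynomial.pderiv y (MvPolynomial.pderiv x f) := by
  classical
  have : ⁅MvPolynomial.pderiv (R := ℂ) x, MvPolynomial.pderiv (R := ℂ) y⁆ = 0 := by
    refine MvPolynomial.derivation_ext fun z => ?_
    rw [Derivation.commutator_apply]
    simp [MvPolynomial.pderiv_X, Pi.single_apply, apply_ite]
  have h := congrArg (fun D => D f) this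
  rw [Derivation.commutator_apply] at h
  exact sub_eq_zero.1 h

/-- The sum may run over any larger set of variables, which puts `f`, `g` and `f * g` on a common
index set. -/
theorem secondOrderPart_eq {σ : Type*} (C : σ → σ → MvPolynomial σ ℂ) {f : MvPolynomial σ ℂ}
    {s : Finset σ} (hs : f.vars ⊆ s) : secondOrderPart C f = (2⁻¹ : ℂ) • ∑ x ∈ s, ∑ y ∈ s,
      C x y * MvPolynomial.pderiv x (MvPolynomial.pderiv y f) := by
  rw [secondOrderPart]
  congr 1
  have h1 : ∀ x, ∑ y ∈ f.vars, C x y * MvPolynomial.pderiv x (MvPolynomial.pderiv y f) =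
      ∑ y ∈ s, C x y * MvPolynomial.pderiv x (MvPolynomial.pderiv y f) := by
    intro x
    refine Finset.sum_subset hs fun y _ hy => ?_
    rw [MvPolynomial.pderiv_eq_zero_of_notMem_vars hy, map_zero, mul_zero]
  rw [Finset.sum_congr rfl fun x _ => h1 x]
  refine Finset.sum_subset hs fun x _ hx => Finset.sum_eq_zero fun y _ => ?_
  rw [pderiv_pderiv_comm, MvPolynomial.pderiv_eq_zero_of_notMem_vars hx, map_zero, mul_zero]

theorem derivation_eq_sum_pderiv {σ : Type*} {M : Type*} [AddCommGroup M]
    [Module (MvPolynomial σ ℂ) M] [Module ℂ M] [IsScalarTower ℂ (MvPolynomial σ ℂ) M]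
    (D : Derivation ℂ (MvPolynomial σ ℂ) M) {f : MvPolynomial σ ℂ} {s : Finset σ}
    (hs : f.vars ⊆ s) :
    D f = ∑ x ∈ s, MvPolynomial.pderiv x f • D (MvPolynomial.X x) := by
  classical
  set E : Derivation ℂ (MvPolynomial σ ℂ) M := ∑ x ∈ s,
    (LinearMap.toSpanSingleton (MvPolynomial σ ℂ) M (D (MvPolynomial.X x))).compDer
      (MvPolynomial.pderiv x) with hE
  have hEapp : ∀ g, E g = ∑ x ∈ s, MvPolynomial.pderiv x g • D (MvPolynomial.X x) := by
    intro g
    rw [hE, ← Derivation.coeFnAddMonoidHom_apply, map_sum, Finset.sum_apply]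
    rfl
  rw [← hEapp]
  refine MvPolynomial.derivation_eqOn_supported (s := (s : Set σ)) (fun y hy => ?_)
    (MvPolynomial.mem_supported.2 (by exact_mod_cast hs))
  rw [Function.comp_apply, Function.comp_apply, hEapp, Finset.sum_eq_single_of_mem y hy]
  · simp
  · intro x _ hx
    rw [MvPolynomial.pderiv_X_of_ne hx.symm, zero_smul]

/-- A second order operator with prescribed values on the variables and prescribed symbol. -/
theorem exists_isSecondOrder {σ : Type*} (J : σ → MvPolynomial σ ℂ)
    (C : σ → σ → MvPolynomial σ ℂ) (hC : ∀ x y, C x y = C y x) :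
    ∃ (L : MvPolynomial σ ℂ →ₗ[ℂ] MvPolynomial σ ℂ)
      (Γ : MvPolynomial σ ℂ →ₗ[ℂ] Derivation ℂ (MvPolynomial σ ℂ) (MvPolynomial σ ℂ)),
      IsSecondOrder L Γ ∧ (∀ x, L (MvPolynomial.X x) = J x) ∧
        ∀ x y, Γ (MvPolynomial.X x) (MvPolynomial.X y) = C x y := by
  classical
  set B : σ → Derivation ℂ (MvPolynomial σ ℂ) (MvPolynomial σ ℂ) :=
    fun x => MvPolynomial.mkDerivation ℂ (fun y => C x y) with hB
  -- A biderivation is a derivation with values in derivations, so it is determined by freely chosen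
  -- values on pairs of variables.
  set Γ : Derivation ℂ (MvPolynomial σ ℂ) (Derivation ℂ (MvPolynomial σ ℂ) (MvPolynomial σ ℂ)) :=
    MvPolynomial.mkDerivation ℂ B with hΓ₀
  have hΓ : ∀ (f g : MvPolynomial σ ℂ) (s : Finset σ), f.vars ⊆ s → g.vars ⊆ s →
      Γ f g = ∑ x ∈ s, ∑ y ∈ s, C x y * (MvPolynomial.pderiv x f * MvPolynomial.pderiv y g) := by
    intro f g s hf hg
    rw [derivation_eq_sum_pderiv Γ hf, ← Derivation.coeFnAddMonoidHom_apply, map_sum,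
      Finset.sum_apply]
    refine Finset.sum_congr rfl fun x _ => ?_
    rw [Derivation.coeFnAddMonoidHom_apply, Derivation.smul_apply, hΓ₀,
      MvPolynomial.mkDerivation_X, hB, derivation_eq_sum_pderiv _ hg, Finset.smul_sum]
    refine Finset.sum_congr rfl fun y _ => ?_
    rw [MvPolynomial.mkDerivation_X, smul_eq_mul, smul_eq_mul]
    ring
  have hsymm : ∀ f g, Γ f g = Γ g f := by
    intro f g
    rw [hΓ f g (f.vars ∪ g.vars) Finset.subset_union_left Finset.subset_union_right,
      hΓ g f (f.vars ∪ g.vars) Finset.subset_union_right Finset.subset_union_left,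
      Finset.sum_comm]
    refine Finset.sum_congr rfl fun x _ => Finset.sum_congr rfl fun y _ => ?_
    rw [hC, mul_comm (MvPolynomial.pderiv y f)]
  have hmul : ∀ f g, secondOrderPart C (f * g) =
      f * secondOrderPart C g + g * secondOrderPart C f + Γ f g := by
    intro f g
    set s := f.vars ∪ g.vars with hs
    have hf : f.vars ⊆ s := Finset.subset_union_left
    have hg : g.vars ⊆ s := Finset.subset_union_right
    -- The Leibniz rule for `∂_x ∂_y` yields the two mixed terms `∂_x f ∂_y g` and `∂_y f ∂_x g`,
    -- each with coefficient `1/2`.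
    have hhalf : Γ f g = (2⁻¹ : ℂ) • (Γ f g + Γ g f) := by
      rw [hsymm g f, ← two_smul ℂ, smul_smul, inv_mul_cancel₀ two_ne_zero, one_smul]
    rw [hhalf, secondOrderPart_eq C (MvPolynomial.vars_mul f g), secondOrderPart_eq C hf,
      secondOrderPart_eq C hg, hΓ f g s hf hg, hΓ g f s hg hf, mul_smul_comm, mul_smul_comm,
      ← smul_add, ← smul_add]
    congr 1
    simp only [Finset.mul_sum, ← Finset.sum_add_distrib]
    refine Finset.sum_congr rfl fun x _ => Finset.sum_congr rfl fun y _ => ?_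
    simp only [Derivation.leibniz, map_add, smul_eq_mul]
    ring
  let K : MvPolynomial σ ℂ →ₗ[ℂ] MvPolynomial σ ℂ :=
    { toFun := secondOrderPart C
      map_add' := by
        intro f g
        rw [secondOrderPart_eq C (MvPolynomial.vars_add_subset f g),
          secondOrderPart_eq C (f := f) (s := f.vars ∪ g.vars) Finset.subset_union_left,
          secondOrderPart_eq C (f := g) (s := f.vars ∪ g.vars) Finset.subset_union_right, ← smul_add]
        simp only [map_add, mul_add, Finset.sum_add_distrib]
      map_smul' := by
        intro c f
        have hc : (c • f).vars ⊆ f.vars := by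
          rw [MvPolynomial.smul_eq_C_mul]
          refine (MvPolynomial.vars_mul _ _).trans ?_
          rw [MvPolynomial.vars_C, Finset.empty_union]
        rw [secondOrderPart_eq C hc, secondOrderPart, RingHom.id_apply, smul_comm c]
        simp only [Derivation.map_smul, mul_smul_comm, Finset.smul_sum] }
  refine ⟨(MvPolynomial.mkDerivation ℂ J : MvPolynomial σ ℂ →ₗ[ℂ] MvPolynomial σ ℂ) + K,
    (Γ : MvPolynomial σ ℂ →ₗ[ℂ] _), ⟨fun f g => ?_, hsymm⟩, fun x => ?_, fun x y => ?_⟩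
  · rw [LinearMap.add_apply, LinearMap.add_apply, LinearMap.add_apply]
    have hK : K (f * g) = f * K g + g * K f + Γ f g := hmul f g
    rw [hK]
    simp only [Derivation.coeFn_coe, Derivation.leibniz, smul_eq_mul]
    ring
  · have hK : K (MvPolynomial.X x) = 0 := by
      change secondOrderPart C (MvPolynomial.X x) = 0
      rw [secondOrderPart, Finset.sum_eq_zero, smul_zero]
      intro y _
      refine Finset.sum_eq_zero fun z _ => ?_
      rw [MvPolynomial.pderiv_X, Pi.single_apply]
      split_ifs <;> simp
    rw [LinearMap.add_apply, hK, add_zero, Derivation.coeFn_coe, MvPolynomial.mkDerivation_X]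
  · rw [Derivation.coeFn_coe, hΓ₀, MvPolynomial.mkDerivation_X, hB, MvPolynomial.mkDerivation_X]

end CutJoinOperator

/-! Fourier variables -/

section Fourier

variable {m : ℕ} [NeZero m]

theorem stdAddChar_mul_eq (a b : ZMod m) :
    (ZMod.stdAddChar (a * b) : ℂ) = xi m ^ (a.val * b.val) := by
  have h : a * b = (((a.val * b.val : ℕ) : ℤ) : ZMod m) := by simp
  rw [h, ZMod.stdAddChar_coe, xi, ← Complex.exp_nat_mul]
  congr 1
  push_cast
  ring

theorem extendZero_fourierVar (c : ZMod m) (r : ℕ) :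
    extendZero (fourierVar m c) r =
      (m : ℂ)⁻¹ • ∑ β : ZMod m, (ZMod.stdAddChar (-(c * β)) : ℂ) • powerVar β r := by
  rcases Nat.eq_zero_or_pos r with rfl | hr
  · simp [powerVar]
  · rw [extendZero, dif_pos hr]
    change (m : ℂ)⁻¹ • (∑ β : ZMod m, ((xi m)⁻¹ ^ (c.val * β.val)) •
      (MvPolynomial.X (β, ⟨r, hr⟩) : PRing m)) = _
    refine congrArg _ (Finset.sum_congr rfl fun β _ => ?_)
    rw [powerVar, extendZero, dif_pos hr, AddChar.map_neg_eq_inv, stdAddChar_mul_eq, inv_pow]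

theorem sum_stdAddChar_mul_sub (c c' : ZMod m) :
    ∑ α : ZMod m, (ZMod.stdAddChar (α * (c' - c)) : ℂ) = if c = c' then (m : ℂ) else 0 := by
  rw [AddChar.sum_mulShift _ (ZMod.isPrimitive_stdAddChar m), ZMod.card]
  simp only [sub_eq_zero, eq_comm, Nat.cast_ite, Nat.cast_zero]

omit [NeZero m] in
theorem powerVar_coe (γ : ZMod m) (r : ℕ+) : powerVar γ r = MvPolynomial.X (γ, r) :=
  extendZero_coe _ r

variable {L : PRing m →ₗ[ℂ] PRing m} {Γ : PRing m →ₗ[ℂ] Derivation ℂ (PRing m) (PRing m)}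

/-- The join relation is a convolution in the colors. After the substitution `γ = α + β` the sum
over `α` is a full character sum, which is `m` for `c = c'` and zero otherwise. -/
theorem symbol_fourierVar
    (hjoin : ∀ (α β : ZMod m) (a b : ℕ),
      Γ (powerVar α a) (powerVar β b) = (m * a * b : ℂ) • powerVar (α + β) (a + b))
    (c c' : ZMod m) (a b : ℕ) :
    Γ (extendZero (fourierVar m c) a) (extendZero (fourierVar m c') b) =
      if c = c' then (m * a * b : ℂ) • extendZero (fourierVar m c) (a + b) else 0 := by
  have hm : (m : ℂ) ≠ 0 := NeZero.ne _
  have h1 : Γ (extendZero (fourierVar m c) a) (extendZero (fourierVar m c') b) =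
      ((m : ℂ)⁻¹ * (m : ℂ)⁻¹ * (m * a * b)) • ∑ α : ZMod m, ∑ β : ZMod m,
        (ZMod.stdAddChar (-(c * α)) * ZMod.stdAddChar (-(c' * β)) : ℂ) •
          powerVar (α + β) (a + b) := by
    have hsum : ∀ (f : ZMod m → PRing m) (g : PRing m), Γ (∑ α, f α) g = ∑ α, Γ (f α) g := by
      intro f g
      rw [map_sum, ← Derivation.coeFnAddMonoidHom_apply, map_sum, Finset.sum_apply]
      rfl
    rw [extendZero_fourierVar, extendZero_fourierVar, LinearMap.map_smul, Derivation.smul_apply,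
      Derivation.map_smul, hsum, smul_smul, mul_smul ((m : ℂ)⁻¹ * (m : ℂ)⁻¹)]
    refine congrArg _ ?_
    rw [Finset.smul_sum]
    refine Finset.sum_congr rfl fun α _ => ?_
    rw [map_sum, Finset.smul_sum]
    refine Finset.sum_congr rfl fun β _ => ?_
    rw [Derivation.map_smul, LinearMap.map_smul, Derivation.smul_apply, hjoin, smul_smul,
      smul_smul, smul_smul]
    congr 1
    ring
  have h2 : ∀ α : ZMod m, ∑ β : ZMod m,
      (ZMod.stdAddChar (-(c * α)) * ZMod.stdAddChar (-(c' * β)) : ℂ) • powerVar (α + β) (a + b) =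
      ∑ γ : ZMod m, (ZMod.stdAddChar (-(c' * γ)) * ZMod.stdAddChar (α * (c' - c)) : ℂ) •
        (powerVar γ (a + b) : PRing m) := by
    intro α
    conv_rhs => rw [← Equiv.sum_comp (Equiv.addLeft α)]
    refine Finset.sum_congr rfl fun β _ => ?_
    rw [Equiv.coe_addLeft, ← AddChar.map_add_eq_mul, ← AddChar.map_add_eq_mul]
    congr 2
    ring
  have h3 : ∀ γ : ZMod m, ∑ α : ZMod m,
      (ZMod.stdAddChar (-(c' * γ)) * ZMod.stdAddChar (α * (c' - c)) : ℂ) •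
        (powerVar γ (a + b) : PRing m) =
      (if c = c' then (m : ℂ) else 0) • (ZMod.stdAddChar (-(c' * γ)) : ℂ) • powerVar γ (a + b) := by
    intro γ
    rw [← Finset.sum_smul, ← Finset.mul_sum, sum_stdAddChar_mul_sub, smul_smul, mul_comm]
  rw [h1, Finset.sum_congr rfl fun α _ => h2 α, Finset.sum_comm,
    Finset.sum_congr rfl fun γ _ => h3 γ, ← Finset.smul_sum]
  split_ifs with h
  · subst h
    rw [extendZero_fourierVar, smul_smul, smul_smul]
    congr 1
    field_simp
  · rw [zero_smul, smul_zero]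

/-- The Fourier transform turns the convolution in the cut relation into a product of two
unnormalized transforms `m P`; with the prefactor `1/m` this leaves the constant `m`. -/
theorem isCutJoinSeq_fourierVar
    (hcut : ∀ (γ : ZMod m) (r : ℕ), L (powerVar γ r) = (r / 2 : ℂ) •
      ∑ β : ZMod m, ∑ ij ∈ Finset.HasAntidiagonal.antidiagonal r,
        powerVar β ij.1 * powerVar (γ - β) ij.2)
    (hjoin : ∀ (α β : ZMod m) (a b : ℕ),
      Γ (powerVar α a) (powerVar β b) = (m * a * b : ℂ) • powerVar (α + β) (a + b))
    (c : ZMod m) : IsCutJoinSeq L Γ m (fourierVar m c) := by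
  have hm : (m : ℂ) ≠ 0 := NeZero.ne _
  refine ⟨fun n => ?_, fun a b => ?_⟩
  · rw [← extendZero_coe (fourierVar m c) n, extendZero_fourierVar, map_smul, map_sum]
    have h1 : ∀ γ : ZMod m, L ((ZMod.stdAddChar (-(c * γ)) : ℂ) • powerVar γ n) =
        (n / 2 : ℂ) • ∑ β : ZMod m, ∑ ij ∈ Finset.HasAntidiagonal.antidiagonal (n : ℕ),
          (ZMod.stdAddChar (-(c * γ)) : ℂ) • (powerVar β ij.1 * powerVar (γ - β) ij.2) := by
      intro γ
      rw [map_smul, hcut, smul_comm]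
      simp only [Finset.smul_sum]
    have h2 : ∑ γ : ZMod m, ∑ β : ZMod m, ∑ ij ∈ Finset.HasAntidiagonal.antidiagonal (n : ℕ),
        (ZMod.stdAddChar (-(c * γ)) : ℂ) • (powerVar β ij.1 * powerVar (γ - β) ij.2) =
        ∑ ij ∈ Finset.HasAntidiagonal.antidiagonal (n : ℕ),
          (∑ β : ZMod m, (ZMod.stdAddChar (-(c * β)) : ℂ) • powerVar β ij.1) *
          ∑ γ : ZMod m, (ZMod.stdAddChar (-(c * γ)) : ℂ) • powerVar γ ij.2 := by
      rw [Finset.sum_comm]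
      have : ∀ β : ZMod m, ∑ γ : ZMod m, ∑ ij ∈ Finset.HasAntidiagonal.antidiagonal (n : ℕ),
          (ZMod.stdAddChar (-(c * γ)) : ℂ) • (powerVar β ij.1 * powerVar (γ - β) ij.2) =
          ∑ ij ∈ Finset.HasAntidiagonal.antidiagonal (n : ℕ), ∑ γ : ZMod m,
          ((ZMod.stdAddChar (-(c * β)) : ℂ) • powerVar β ij.1) *
          ((ZMod.stdAddChar (-(c * γ)) : ℂ) • powerVar γ ij.2) := by
        intro β
        rw [Finset.sum_comm]
        refine Finset.sum_congr rfl fun ij _ => ?_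
        rw [← Equiv.sum_comp (Equiv.addRight β)]
        refine Finset.sum_congr rfl fun γ _ => ?_
        rw [Equiv.coe_addRight, add_sub_cancel_right, smul_mul_smul_comm,
          ← AddChar.map_add_eq_mul]
        congr 2
        ring
      rw [Finset.sum_congr rfl fun β _ => this β, Finset.sum_comm]
      exact Finset.sum_congr rfl fun ij _ => (Finset.sum_mul_sum _ _ _ _).symm
    rw [Finset.sum_congr rfl fun γ _ => h1 γ, ← Finset.smul_sum, h2, smul_smul]
    simp only [extendZero_fourierVar, smul_mul_smul_comm]
    rw [← Finset.smul_sum, smul_smul]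
    congr 1
    field_simp
  · have := symbol_fourierVar hjoin c c a b
    rw [if_pos rfl, extendZero_coe, extendZero_coe] at this
    rw [this]
    congr 1
    exact extendZero_coe (fourierVar m c) (a + b)

/-- A shift of colors by `k` becomes multiplication by the character value at `k c`. -/
theorem derivation_fourierVar {k : ZMod m} {D : Derivation ℂ (PRing m) (PRing m)}
    (hD : ∀ (γ : ZMod m) (r : ℕ), D (powerVar γ r) = (r : ℂ) • powerVar (γ + k) r) (c : ZMod m)
    (n : ℕ+) :
    D (fourierVar m c n) = ((ZMod.stdAddChar (k * c) : ℂ) * n) • fourierVar m c n := by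
  rw [← extendZero_coe (fourierVar m c) n, extendZero_fourierVar, Derivation.map_smul, map_sum,
    smul_comm]
  congr 1
  rw [Finset.smul_sum]
  conv_rhs => rw [← Equiv.sum_comp (Equiv.addRight k)]
  rw [Equiv.coe_addRight]
  refine Finset.sum_congr rfl fun β _ => ?_
  rw [Derivation.map_smul, hD, smul_smul, smul_smul, mul_right_comm, ← AddChar.map_add_eq_mul]
  congr 3
  ring

end Fourier

/-! Schur polynomials do not vanish -/

section Nonvanishing

theorem AlgHom.map_hPoly {A B : Type*} [CommRing A] [Algebra ℂ A] [CommRing B] [Algebra ℂ B]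
    (φ : A →ₐ[ℂ] B) (x : ℕ+ → A) (n : ℕ) : φ (hPoly x n) = hPoly (fun k => φ (x k)) n := by
  induction n using Nat.strong_induction_on with
  | _ n ih =>
    cases n with
    | zero => simp
    | succ n =>
      rw [hPoly, hPoly, map_smul, map_sum]
      congr 1
      refine Finset.sum_congr rfl fun k _ => ?_
      rw [map_mul, ih (n - k) (by omega)]

theorem AlgHom.map_schurPoly {A B : Type*} [CommRing A] [Algebra ℂ A] [CommRing B] [Algebra ℂ B]
    (φ : A →ₐ[ℂ] B) (x : ℕ+ → A) (μ : YoungDiagram) :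
    φ (schurPoly μ x) = schurPoly μ (fun k => φ (x k)) := by
  rw [schurPoly, schurPoly, AlgHom.map_det]
  congr 1
  ext i j
  simp only [AlgHom.mapMatrix_apply, Matrix.map_apply, Matrix.of_apply]
  split_ifs
  · exact φ.map_hPoly x _
  · exact map_zero φ

/-- For `x = (1, 0, 0, ...)` the generating series is `exp t`. -/
theorem hPoly_single_one (n : ℕ) :
    hPoly (Pi.single 1 1 : ℕ+ → ℂ) n = ((Nat.factorial n : ℕ) : ℂ)⁻¹ := by
  induction n with
  | zero => simp
  | succ n ih =>
    rw [hPoly, Finset.sum_eq_single 0]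
    · have : Nat.succPNat ((0 : Fin (n + 1)) : ℕ) = 1 := rfl
      rw [this, Pi.single_eq_same, Fin.val_zero, Nat.sub_zero, ih, Nat.factorial_succ]
      push_cast
      rw [one_mul, smul_eq_mul, mul_inv]
    · intro k _ hk
      have : Nat.succPNat (k : ℕ) ≠ 1 := by
        intro h
        have h' := congrArg PNat.val h
        rw [Nat.succPNat_coe] at h'
        exact hk (Fin.ext (Nat.succ_injective h'))
      rw [Pi.single_eq_of_ne this, zero_mul]
    · simp

theorem hInt_single_one (l k : ℕ) :
    hInt (Pi.single 1 1 : ℕ+ → ℂ) ((l : ℤ) - k) =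
      ((Nat.factorial l : ℕ) : ℂ)⁻¹ * (descPochhammer ℂ k).eval (l : ℂ) := by
  rw [descPochhammer_eval_eq_descFactorial]
  rcases le_or_gt k l with h | h
  · rw [← Nat.cast_sub h, hInt_natCast, hPoly_single_one, ← Nat.factorial_mul_descFactorial h]
    have h1 : ((Nat.factorial (l - k) : ℕ) : ℂ) ≠ 0 := by exact_mod_cast Nat.factorial_ne_zero _
    have h2 : ((Nat.descFactorial l k : ℕ) : ℂ) ≠ 0 := by
      rw [Ne, Nat.cast_eq_zero, Nat.descFactorial_eq_zero_iff_lt]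
      omega
    push_cast
    field_simp
  · rw [hInt_of_neg _ (by omega), Nat.descFactorial_eq_zero_iff_lt.2 h, Nat.cast_zero, mul_zero]

/-- After reversing the columns and removing `1 / l_i!` from the rows, with `l_i = λ_i + N - 1 - i`,
the entries are falling factorials of `l_i`. These are monic of degree `j`, so the determinant is
the Vandermonde determinant of the `l_i`, which are strictly decreasing. -/
theorem schurPoly_single_one_ne_zero (μ : YoungDiagram) :
    schurPoly μ (Pi.single 1 1 : ℕ+ → ℂ) ≠ 0 := by
  rw [schurPoly_eq_det]
  set N := μ.colLen 0 with hN
  set l : Fin N → ℕ := fun i => μ.rowLen i + (N - 1 - i) with hl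
  set v : Fin N → ℂ := fun i => l i with hv
  have hsub : (hMatrix (Pi.single 1 1 : ℕ+ → ℂ) fun i : Fin N =>
      (μ.rowLen i : ℤ) - (i : ℕ)).submatrix id Fin.revPerm = Matrix.of fun i j =>
      ((Nat.factorial (l i) : ℕ) : ℂ)⁻¹ *
        (Matrix.of fun i j : Fin N => (descPochhammer ℂ j).eval (v i)) i j := by
    ext i j
    simp only [Matrix.submatrix_apply, hMatrix, Matrix.of_apply, hv, id]
    rw [← hInt_single_one]
    congr 1
    simp only [hl, Fin.revPerm_apply, Fin.val_rev]
    omega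
  have hdet := Matrix.det_permute' Fin.revPerm (hMatrix (Pi.single 1 1 : ℕ+ → ℂ) fun i : Fin N =>
      (μ.rowLen i : ℤ) - (i : ℕ))
  rw [hsub, Matrix.det_mul_column, ← Matrix.det_eval_matrixOfPolynomials_eq_det_vandermonde v
    (fun j => descPochhammer ℂ j) (fun j => descPochhammer_natDegree ℂ j)
    (fun j => monic_descPochhammer ℂ j)] at hdet
  intro h0
  rw [h0, mul_zero, mul_eq_zero] at hdet
  rcases hdet with h | h
  · rw [Finset.prod_eq_zero_iff] at h
    obtain ⟨i, -, hi⟩ := h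
    exact inv_ne_zero (Nat.cast_ne_zero.2 (Nat.factorial_ne_zero (l i))) hi
  · refine Matrix.det_vandermonde_ne_zero_iff.2 ?_ h
    have hanti : StrictAnti l := by
      intro i j hij
      have h1 := μ.rowLen_anti i j hij.le
      simp only [hl]
      have h2 : (i : ℕ) < j := hij
      have h3 := j.isLt
      omega
    exact fun i j hij => hanti.injective (Nat.cast_injective hij)

/-- The specialization inverts the Fourier transform for the single color `c`, giving `P^{(c)} = (1,
0, 0, ...)`. Treating one color at a time suffices because the polynomial ring is a domain. -/
theorem schurPoly_fourierVar_ne_zero {m : ℕ} [NeZero m] (μ : YoungDiagram) (c : ZMod m) :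
    schurPoly μ (fourierVar m c) ≠ 0 := by
  set φ : PRing m →ₐ[ℂ] ℂ := MvPolynomial.aeval fun x : ZMod m × ℕ+ =>
    (ZMod.stdAddChar (c * x.1) : ℂ) * (Pi.single 1 1 : ℕ+ → ℂ) x.2 with hφ
  have h : ∀ k, φ (fourierVar m c k) = (Pi.single 1 1 : ℕ+ → ℂ) k := by
    intro k
    rw [← extendZero_coe (fourierVar m c) k, extendZero_fourierVar, map_smul, map_sum]
    have : ∀ β ∈ Finset.univ, φ ((ZMod.stdAddChar (-(c * β)) : ℂ) • powerVar β k) =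
        (Pi.single 1 1 : ℕ+ → ℂ) k := by
      intro β _
      rw [map_smul, powerVar_coe, hφ, MvPolynomial.aeval_X, smul_eq_mul, ← mul_assoc,
        ← AddChar.map_add_eq_mul, neg_add_cancel, AddChar.map_zero_eq_one, one_mul]
    rw [Finset.sum_congr rfl this, Finset.sum_const, Finset.card_univ, ZMod.card,
      ← Nat.cast_smul_eq_nsmul ℂ, smul_smul, inv_mul_cancel₀ (NeZero.ne _), one_smul]
  intro h0
  have h1 := φ.map_schurPoly (fourierVar m c) μ
  rw [h0, map_zero, funext h] at h1
  exact schurPoly_single_one_ne_zero μ h1.symm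

theorem coloredSchur_ne_zero (m : ℕ) [NeZero m] (lam : ZMod m → YoungDiagram) :
    coloredSchur m lam ≠ 0 :=
  Finset.prod_ne_zero_iff.2 fun c _ => schurPoly_fourierVar_ne_zero (lam c) c

end Nonvanishing

/-! Eigenvalues -/

section Eigenvalues

variable {m : ℕ} [NeZero m]

theorem exists_cutJoin_zero_eq (m : ℕ) [NeZero m] :
    ∃ Γ : PRing m →ₗ[ℂ] Derivation ℂ (PRing m) (PRing m), IsSecondOrder (cutJoin m 0) Γ ∧
      (∀ (γ : ZMod m) (r : ℕ), cutJoin m 0 (powerVar γ r) = (r / 2 : ℂ) •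
        ∑ β : ZMod m, ∑ ij ∈ Finset.HasAntidiagonal.antidiagonal r,
          powerVar β ij.1 * powerVar (γ - β) ij.2) ∧
      ∀ (α β : ZMod m) (a b : ℕ),
        Γ (powerVar α a) (powerVar β b) = (m * a * b : ℂ) • powerVar (α + β) (a + b) := by
  obtain ⟨L, Γ, hL, hJ, hC⟩ := exists_isSecondOrder
    (fun x : ZMod m × ℕ+ => ((x.2 : ℕ) / 2 : ℂ) •
      ∑ β : ZMod m, ∑ ij ∈ Finset.HasAntidiagonal.antidiagonal (x.2 : ℕ),
        powerVar β ij.1 * powerVar (x.1 - β) ij.2)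
    (fun x y => (m * (x.2 : ℕ) * (y.2 : ℕ) : ℂ) • powerVar (x.1 + y.1) (x.2 + y.2 : ℕ))
    (fun x y => by rw [add_comm x.1, add_comm (x.2 : ℕ), mul_right_comm])
  have hcut : ∀ (γ : ZMod m) (r : ℕ), L (powerVar γ r) = (r / 2 : ℂ) •
      ∑ β : ZMod m, ∑ ij ∈ Finset.HasAntidiagonal.antidiagonal r,
        powerVar β ij.1 * powerVar (γ - β) ij.2 := by
    intro γ r
    rcases Nat.eq_zero_or_pos r with rfl | hr
    · simp [powerVar]
    · lift r to ℕ+ using hr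
      rw [powerVar_coe, hJ]
  have hjoin : ∀ (α β : ZMod m) (a b : ℕ),
      Γ (powerVar α a) (powerVar β b) = (m * a * b : ℂ) • powerVar (α + β) (a + b) := by
    intro α β a b
    rcases Nat.eq_zero_or_pos a with rfl | ha
    · simp [powerVar]
    rcases Nat.eq_zero_or_pos b with rfl | hb
    · simp [powerVar]
    lift a to ℕ+ using ha
    lift b to ℕ+ using hb
    rw [powerVar_coe, powerVar_coe, hC]
  rw [cutJoin_zero_eq hL hcut hjoin]
  exact ⟨Γ, hL, hcut, hjoin⟩

/-- The symbol vanishes between different Fourier colors, so on this product the second order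
operator obeys the Leibniz rule and the eigenvalues of the factors add up. -/
theorem cutJoin_zero_coloredSchur (lam : ZMod m → YoungDiagram) :
    cutJoin m 0 (coloredSchur m lam) =
      ((m : ℂ) / 2 * ∑ α : ZMod m, ∑ i ∈ Finset.range ((lam α).colLen 0),
        ((lam α).rowLen i : ℂ) * ((lam α).rowLen i - 2 * (i + 1) + 1)) • coloredSchur m lam := by
  classical
  obtain ⟨Γ, hL, hcut, hjoin⟩ := exists_cutJoin_zero_eq m
  have hΓ : ∀ α β : ZMod m, β ≠ α →
      Γ (schurPoly (lam α) (fourierVar m α)) (schurPoly (lam β) (fourierVar m β)) = 0 := by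
    intro α β hβ
    refine symbol_schurPoly_eq_zero hL _ _ (fun i j => ?_) _ _
    have := symbol_fourierVar hjoin α β i j
    rwa [if_neg hβ.symm, extendZero_coe, extendZero_coe] at this
  rw [coloredSchur, hL.map_prod]
  have h2 : ∑ α : ZMod m, ∑ β ∈ Finset.univ.erase α,
      Γ (schurPoly (lam α) (fourierVar m α)) (schurPoly (lam β) (fourierVar m β)) *
        ∏ k ∈ (Finset.univ.erase α).erase β, schurPoly (lam k) (fourierVar m k) = 0 := by
    refine Finset.sum_eq_zero fun α _ => Finset.sum_eq_zero fun β hβ => ?_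
    rw [hΓ α β (Finset.ne_of_mem_erase hβ), zero_mul]
  rw [h2, smul_zero, add_zero, Finset.mul_sum, Finset.sum_smul]
  refine Finset.sum_congr rfl fun α _ => ?_
  rw [(isCutJoinSeq_fourierVar hcut hjoin α).map_schurPoly hL, smul_mul_assoc,
    Finset.mul_prod_erase _ (fun α => schurPoly (lam α) (fourierVar m α)) (Finset.mem_univ α)]

theorem cutJoin_coloredSchur {k : ZMod m} (hk : k ≠ 0) (lam : ZMod m → YoungDiagram) :
    cutJoin m k (coloredSchur m lam) =
      (∑ α : ZMod m, ∑ i ∈ Finset.range ((lam α).colLen 0),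
        xi m ^ (k.val * α.val) * ((lam α).rowLen i : ℂ)) • coloredSchur m lam := by
  classical
  set D : Derivation ℂ (PRing m) (PRing m) := MvPolynomial.mkDerivation ℂ
    fun x : ZMod m × ℕ+ => ((x.2 : ℕ) : ℂ) • powerVar (x.1 + k) x.2 with hDdef
  have hD : ∀ (γ : ZMod m) (r : ℕ), D (powerVar γ r) = (r : ℂ) • powerVar (γ + k) r := by
    intro γ r
    rcases Nat.eq_zero_or_pos r with rfl | hr
    · simp [powerVar]
    · lift r to ℕ+ using hr
      rw [powerVar_coe, hDdef, MvPolynomial.mkDerivation_X]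
  rw [cutJoin_eq_derivation hk hD, Derivation.coeFn_coe, coloredSchur, Derivation.map_prod',
    Finset.sum_smul]
  refine Finset.sum_congr rfl fun α _ => ?_
  rw [derivation_schurPoly D (derivation_fourierVar hD α), smul_mul_assoc,
    Finset.mul_prod_erase _ (fun α => schurPoly (lam α) (fourierVar m α)) (Finset.mem_univ α),
    stdAddChar_mul_eq, Finset.mul_sum]

end Eigenvalues

/-! ### The eigenvector theorem -/

theorem mainTheorem3 (m : ℕ) [NeZero m] (lam : ZMod m → YoungDiagram) :
    (cutJoin m 0).HasEigenvector
        ((m : ℂ) / 2 * ∑ α : ZMod m, ∑ i ∈ Finset.range ((lam α).colLen 0),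
          ((lam α).rowLen i : ℂ) * ((lam α).rowLen i - 2 * (i + 1) + 1))
        (coloredSchur m lam) ∧
      ∀ k : ZMod m, k ≠ 0 →
        (cutJoin m k).HasEigenvector
          (∑ α : ZMod m, ∑ i ∈ Finset.range ((lam α).colLen 0),
            xi m ^ (k.val * α.val) * ((lam α).rowLen i : ℂ))
          (coloredSchur m lam) :=
  ⟨Module.End.hasEigenvector_iff.2 ⟨Module.End.mem_eigenspace_iff.2 (cutJoin_zero_coloredSchur lam),
    coloredSchur_ne_zero m lam⟩, fun _ hk => Module.End.hasEigenvector_iff.2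
    ⟨Module.End.mem_eigenspace_iff.2 (cutJoin_coloredSchur hk lam), coloredSchur_ne_zero m lam⟩⟩
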